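/- For a linear program $\max\{c\cdot z : z\in P\}$ given by a system $A$ of linear inequalities in variables $z\in\mathbb{R}^V$, the $r$-round semantic Cutting Planes (sCP) relaxation adds to $A$ every inequality that has an sCP proof of depth at most $r$ from $A$. Here the inequalities of $A$ have depth $0$, and from inequalities $J$ and $K$ of depth at most $d$ one may deduce, in depth $d+1$, any inequality $I$ with real coefficients such that every $z\in\{0,1\}^V$ satisfying $J$ and $K$ satisfies $I$. The integrality gap of the $r$-round relaxation is the optimum of the relaxation divided by the optimum over the integral solutions of the original program. For a clause $C=\bigvee_{j\in P}x_j\vee\bigvee_{j\in N}\overline{x_j}$ let $E(C)=\sum_{j\in P}x_j+\sum_{j\in N}(1-x_j)$. A formula $F$ with $m$ constraints on $x_1,\dots,x_n$, each constraint $i$ being a clause or a linear equation mod $2$ written as a CNF $F_i$ over its own variables (for a clause $C_i$, $F_i=\{C_i\}$; for an equation in $k$ variables, $F_i$ consists of the $2^{k-1}$ clauses on exactly these variables that it implies), has the linear program $$\max\sum_{i=1}^m y_i\quad\text{subject to}\quad E(C)\ge y_i\ (i\in[m],\ C\in F_i),\quad 0\le x_j\le1\ (j\in[n]),\quad 0\le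 y_i\le 1\ (i\in[m]).$$ Let $\mathrm{XOR}(m,n,k)$ (respectively $\mathcal F(m,n,k)$) be the distribution of $m$ independent uniformly random mod-$2$ linear equations (respectively clauses) with exactly $k$ distinct variables among $x_1,\dots,x_n$. **Theorem.** For every $\varepsilon>0$ and every integer $k\ge6$: 1. There are $\kappa>0$ and $m=m(n)=O(n)$ such that for $F\sim\mathrm{XOR}(m,n,k)$ the integrality gap of the $\lfloor\kappa n\rfloor$-round sCP relaxation of the linear program of $F$ is at least $2-\varepsilon$ with probability tending to $1$ as $n\to\infty$. 2. There are $\kappa>0$ and $m=m(n)=O(n)$ such that for $F\sim\mathcal F(m,n,k)$ the integrality gap of the $\lfloor\kappa n\rfloor$-round sCP relaxation of the linear program of $F$ is at least $\frac{2^k}{2^k-1}-\varepsilon$ with probability tending to $1$ as $n\to\infty$. -/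

import Mathlib

/-! ### Linear inequalities, semantic Cutting Planes, and the `r`-round relaxation -/

/-- The linear inequality `∑ v, coeff v * z v ≥ bound` in the real variables `z v`, `v : V`. -/
structure LinIneq (V : Type) where
  coeff : V → ℝ
  bound : ℝ

namespace LinIneq

/-- The point `z` satisfies the inequality. -/
def Holds {V : Type} [Fintype V] (I : LinIneq V) (z : V → ℝ) : Prop :=
  I.bound ≤ ∑ v, I.coeff v * z v

end LinIneq

/-- The `{0,1}`-points of `ℝ^V`. -/
def IsBoolean {V : Type} (z : V → ℝ) : Prop :=
  ∀ v, z v = 0 ∨ z v = 1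

/-- `SCPDerives A d I`: the inequality `I` has a semantic Cutting Planes proof from the system `A`
whose proof DAG has depth (length of a longest path) at most `d`. Lines of `A` have depth `0`; a
semantic deduction from two lines (possibly equal) of depth at most `d` has depth at most `d + 1`.
Sharing of lines is irrelevant for the depth, so the DAG may be unfolded into a tree. -/
inductive SCPDerives {V : Type} [Fintype V] (A : Set (LinIneq V)) : ℕ → LinIneq V → Prop
  | hyp (d : ℕ) (I : LinIneq V) (hI : I ∈ A) : SCPDerives A d I
  | deduce (d : ℕ) (J K I : LinIneq V) (hJ : SCPDerives A d J) (hK : SCPDerives A d K)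
      (sound : ∀ z : V → ℝ, IsBoolean z → J.Holds z → K.Holds z → I.Holds z) :
      SCPDerives A (d + 1) I

/-- A linear program: maximize `∑ v, objective v * z v` subject to a system of inequalities. -/
structure LinProg (V : Type) where
  constraints : Set (LinIneq V)
  objective : V → ℝ

namespace LinProg

variable {V : Type} [Fintype V]

/-- The value of the objective at a point. -/
def value (L : LinProg V) (z : V → ℝ) : ℝ :=
  ∑ v, L.objective v * z v

/-- The feasible region. -/
def feasible (L : LinProg V) : Set (V → ℝ) :=
  {z | ∀ I ∈ L.constraints, I.Holds z}

/-- The `r`-round semantic Cutting Planes relaxation: all inequalities derivable in depth `r`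
are added to the constraints. -/
def scpRelaxation (L : LinProg V) (r : ℕ) : LinProg V where
  constraints := L.constraints ∪ {I | SCPDerives L.constraints r I}
  objective := L.objective

/-- The optimal value of the linear program. -/
noncomputable def optimum (L : LinProg V) : ℝ :=
  sSup (L.value '' L.feasible)

/-- The optimal value among the integral feasible points. -/
noncomputable def integralOptimum (L : LinProg V) : ℝ :=
  sSup (L.value '' {z | z ∈ L.feasible ∧ ∀ v, ∃ t : ℤ, z v = t})

/-- The integrality gap of the `r`-round semantic Cutting Planes relaxation of `L`: the optimum of
the relaxation divided by the optimum over the integral solutions of `L`. -/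
noncomputable def scpGap (L : LinProg V) (r : ℕ) : ℝ :=
  (L.scpRelaxation r).optimum / L.integralOptimum

end LinProg

/-! ### Clauses, equations mod 2, and their linear programs -/

/-- The clause `⋁_{j ∈ pos} x_j ∨ ⋁_{j ∈ neg} ¬ x_j`. -/
structure XClause (n : ℕ) where
  pos : Finset (Fin n)
  neg : Finset (Fin n)

/-- The inequality `∑_{j ∈ pos} x_j + ∑_{j ∈ neg} (1 - x_j) ≥ y_i`, that is,
`∑_{j ∈ pos} x_j - ∑_{j ∈ neg} x_j - y_i ≥ -|neg|`.
The variables `x_j` are indexed by `Fin n`, the variables `y_i` by `Fin m`. -/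
def XClause.ineq {n m : ℕ} (C : XClause n) (i : Fin m) : LinIneq (Fin n ⊕ Fin m) where
  coeff := Sum.elim
    (fun j => (if j ∈ C.pos then 1 else 0) - (if j ∈ C.neg then 1 else 0))
    (fun i' => if i' = i then -1 else 0)
  bound := -(C.neg.card : ℝ)

/-- The inequality `z v ≥ 0`. -/
def lowerIneq {V : Type} [DecidableEq V] (v : V) : LinIneq V where
  coeff := fun w => if w = v then 1 else 0
  bound := 0

/-- The inequality `z v ≤ 1`, written as `- z v ≥ -1`. -/
def upperIneq {V : Type} [DecidableEq V] (v : V) : LinIneq V where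
  coeff := fun w => if w = v then -1 else 0
  bound := -1

/-- The linear program of `m` constraints on `x_1, …, x_n`, the `i`-th of which is written as the
conjunction of the clauses in `enc i`: maximize `∑ i, y_i` subject to `E(C) ≥ y_i` for `C ∈ enc i`
and `0 ≤ x_j ≤ 1`, `0 ≤ y_i ≤ 1`. -/
def maxLP {n m : ℕ} (enc : Fin m → Set (XClause n)) : LinProg (Fin n ⊕ Fin m) where
  constraints := {I | (∃ i, ∃ C ∈ enc i, I = C.ineq i) ∨ ∃ v, I = lowerIneq v ∨ I = upperIneq v}
  objective := Sum.elim (fun _ => 0) (fun _ => 1)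

/-- Clauses with exactly `k` variables, as pairs (positive variables, negated variables). -/
abbrev KClause (n k : ℕ) : Type :=
  {C : Finset (Fin n) × Finset (Fin n) // Disjoint C.1 C.2 ∧ C.1.card + C.2.card = k}

/-- Linear equations `∑_{j ∈ S} x_j = b` mod 2 with exactly `k` variables, as pairs `(S, b)`. -/
abbrev KXor (n k : ℕ) : Type :=
  {S : Finset (Fin n) // S.card = k} × ZMod 2

/-- The clausal encoding of the equation `∑_{j ∈ S} x_j = b` mod 2. The clause with variable set `S`
and negated variables `N` excludes exactly the assignment to `S` that is `1` on `N` and `0` on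
`S \ N`, so it belongs to the encoding when `|N| ≠ b` mod 2. -/
def KXor.clauses {n k : ℕ} (e : KXor n k) : Set (XClause n) :=
  {C | ∃ N ⊆ e.1.1, (N.card : ZMod 2) ≠ e.2 ∧ C = ⟨e.1.1 \ N, N⟩}

/-- The linear program of a `k`-CNF formula with `m` clauses. -/
def cnfLP {n m k : ℕ} (F : Fin m → KClause n k) : LinProg (Fin n ⊕ Fin m) :=
  maxLP fun i => {⟨(F i).1.1, (F i).1.2⟩}

/-- The linear program of a `k`-XOR formula with `m` equations; there is one `y_i` per equation. -/
def xorLP {n m k : ℕ} (F : Fin m → KXor n k) : LinProg (Fin n ⊕ Fin m) :=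
  maxLP fun i => (F i).clauses

/-! ### Random formulas -/

/-- The probability of the event `P` when `m` elements of the finite type `α` are drawn
independently and uniformly, i.e. under the uniform distribution on `Fin m → α`. -/
noncomputable def uniformProb {α : Type} [Fintype α] (m : ℕ) (P : (Fin m → α) → Prop) : ℝ :=
  (Nat.card {F : Fin m → α // P F} : ℝ) / (Nat.card (Fin m → α) : ℝ)

/-! For both random models, some fractional point of value `m` survives all rounds, while no
assignment satisfies much more than a fraction `q` of the constraints, with `q = 1/2` for equations
and `q = 1 - 2⁻ᵏ` for clauses. The surviving point has every `x_j = 1/2` and every `y_i = 1`. A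
clause is implied by a suitable equation on its variables, so the survival argument is carried out
for equations only.

One deduction (`holds_of_holds_two_rounded`): let `z` be half-integral and let the premises hold
whenever at most two of its half coordinates are rounded. Two linear forms can be balanced by signs
`s` up to the weight of two coordinates, so both premises hold at the Boolean points `z + s/2` and
`z - s/2`, where `s` lives on the half coordinates. Soundness gives the conclusion at both, hence at
their midpoint `z`.

Iteration (`IsProtected.holds`): the invariant is a half-integral point whose integral coordinates
are a small set `A` together with the variables of a closure `T` of `A`, all equations of `T` being
satisfied. After two more coordinates are rounded, the closure may grow. Expansion leaves enough
free unique neighbours to solve the new equations in complementary ways, so the rounded point lies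
in the convex hull of points that again satisfy the invariant. Convex hulls enter as quantification
over midpoint-closed properties (`MidConvex`). Each round adds at most two elements to `A`, so
expansion up to linear size protects against linearly many rounds.

Probability (`exists_tendsto_uniformProb_one`): for `m = D * n` with `D` large, a first-moment bound
gives expansion up to linear size. A Chernoff bound with a union over the `2ⁿ` assignments controls
the satisfiable fraction. -/

open Finset

/-! ### Balancing two linear forms -/

/-- Two linear forms on a cube `[-1, 1]^E` can be annihilated simultaneously by a point with at most
two coordinates different from `±1`. -/
theorem exists_annihilating_almost_vertex {V : Type} [Fintype V] (E : Finset V) (a b : V → ℝ) :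
    ∃ p : V → ℝ, (∀ v, |p v| ≤ 1) ∧ (∀ v ∉ E, p v = 0) ∧ ∑ v, a v * p v = 0 ∧
      ∑ v, b v * p v = 0 ∧ #{v ∈ E | |p v| ≠ 1} ≤ 2 := by
  classical
  let C : Set (V → ℝ) := {p | (∀ v, |p v| ≤ 1) ∧ (∀ v, v ∉ E → p v = 0) ∧ ∑ v, a v * p v = 0 ∧
      ∑ v, b v * p v = 0}
  have hclosed : IsClosed C := by
    have h1 : IsClosed {p : V → ℝ | ∀ v, |p v| ≤ 1} := by
      simp only [Set.ofPred_forall]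
      exact isClosed_iInter fun v => isClosed_le (by fun_prop) (by fun_prop)
    have h2 : IsClosed {p : V → ℝ | ∀ v, v ∉ E → p v = 0} := by
      simp only [Set.ofPred_forall]
      exact isClosed_iInter fun v => isClosed_iInter fun _ => isClosed_eq (by fun_prop) (by fun_prop)
    exact h1.inter (h2.inter ((isClosed_eq (by fun_prop) (by fun_prop)).inter
      (isClosed_eq (by fun_prop) (by fun_prop))))
  have hcpt : IsCompact C := by
    refine IsCompact.of_isClosed_subset (isCompact_Icc (a := fun _ : V => (-1 : ℝ)) (b := fun _ => 1))
      hclosed ?_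
    rintro p ⟨hp, -⟩
    exact ⟨fun v => (abs_le.1 (hp v)).1, fun v => (abs_le.1 (hp v)).2⟩
  -- A maximizer of the strictly convex function `∑ p v ^ 2` plays the role of an extreme point of
  -- `C`.
  obtain ⟨p, ⟨hp1, hp2, hp3, hp4⟩, hmax⟩ := hcpt.exists_isMaxOn
    ⟨0, by simp [C]⟩ (f := fun p : V → ℝ => ∑ v, p v ^ 2) (by fun_prop)
  refine ⟨p, hp1, hp2, hp3, hp4, ?_⟩
  by_contra! hcard
  set F := {v ∈ E | |p v| ≠ 1} with hF
  let f : (F → ℝ) →ₗ[ℝ] ℝ × ℝ := LinearMap.prod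
    (∑ v : F, a v • LinearMap.proj v) (∑ v : F, b v • LinearMap.proj v)
  -- At least three free coordinates against two equations leave a direction along which `p` can
  -- move both ways inside `C`.
  have hker : LinearMap.ker f ≠ ⊥ := LinearMap.ker_ne_bot_of_finrank_lt (by simpa using hcard)
  obtain ⟨d, hd, hd0⟩ := Submodule.exists_mem_ne_zero_of_ne_bot hker
  have hd' : ∑ v : F, a v * d v = 0 ∧ ∑ v : F, b v * d v = 0 := by
    simpa [f, LinearMap.mem_ker, Prod.ext_iff] using hd
  let e : V → ℝ := fun v => if h : v ∈ F then d ⟨v, h⟩ else 0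
  have hsum : ∀ c : V → ℝ, ∑ v, c v * e v = ∑ v : F, c v * d v := by
    intro c
    rw [← Finset.sum_subset (Finset.subset_univ F) (by intro v _ hv; simp [e, hv]),
      ← Finset.sum_coe_sort F]
    exact Finset.sum_congr rfl fun v _ => by simp [e]
  have hsmall : ∀ᶠ t in nhdsWithin (0 : ℝ) (Set.Ioi 0), ∀ v ∈ F, |p v| + t * |e v| < 1 := by
    rw [Filter.eventually_all_finset]
    intro v hv
    have hlt : |p v| < 1 := lt_of_le_of_ne (hp1 v) (Finset.mem_filter.1 hv).2
    have hcont : Filter.Tendsto (fun t : ℝ => |p v| + t * |e v|) (nhdsWithin 0 (Set.Ioi 0))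
        (nhds (|p v| + 0 * |e v|)) :=
      (Continuous.tendsto (by fun_prop) 0).mono_left nhdsWithin_le_nhds
    exact hcont.eventually_lt_const (by simpa using hlt)
  obtain ⟨t, ht, ht0⟩ := (hsmall.and self_mem_nhdsWithin).exists
  have ht0 : 0 < t := ht0
  have hmem : ∀ σ : ℝ, |σ| = 1 → (fun v => p v + σ * t * e v) ∈ C := by
    intro σ hσ
    refine ⟨fun v => ?_, fun v hv => ?_, ?_, ?_⟩
    · by_cases hv : v ∈ F
      · calc |p v + σ * t * e v| ≤ |p v| + |σ * t * e v| := abs_add_le _ _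
          _ = |p v| + t * |e v| := by rw [abs_mul, abs_mul, hσ, abs_of_pos ht0, one_mul]
          _ ≤ 1 := (ht v hv).le
      · simpa [e, hv] using hp1 v
    · have : v ∉ F := fun h => hv (Finset.mem_filter.1 h).1
      simp [e, this, hp2 v hv]
    · have : ∑ v, a v * (p v + σ * t * e v) = ∑ v, a v * p v + σ * t * ∑ v, a v * e v := by
        rw [Finset.mul_sum, ← Finset.sum_add_distrib]
        exact Finset.sum_congr rfl fun v _ => by ring
      rw [this, hp3, hsum, hd'.1]; ring
    · have : ∑ v, b v * (p v + σ * t * e v) = ∑ v, b v * p v + σ * t * ∑ v, b v * e v := by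
        rw [Finset.mul_sum, ← Finset.sum_add_distrib]
        exact Finset.sum_congr rfl fun v _ => by ring
      rw [this, hp4, hsum, hd'.2]; ring
  have h1 := hmax (hmem 1 (by simp))
  have h2 := hmax (hmem (-1) (by simp))
  simp only [Set.mem_ofPred_eq] at h1 h2
  -- By the parallelogram law one of the two moves increases the sum of squares, against maximality.
  have hexp : ∑ v, (p v + 1 * t * e v) ^ 2 + ∑ v, (p v + -1 * t * e v) ^ 2 =
      2 * ∑ v, p v ^ 2 + 2 * t ^ 2 * ∑ v, e v ^ 2 := by
    rw [Finset.mul_sum, Finset.mul_sum, ← Finset.sum_add_distrib, ← Finset.sum_add_distrib]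
    exact Finset.sum_congr rfl fun v _ => by ring
  have hpos : 0 < ∑ v, e v ^ 2 := by
    obtain ⟨w, hw⟩ := Function.ne_iff.1 hd0
    refine Finset.sum_pos' (fun v _ => sq_nonneg _) ⟨w, Finset.mem_univ _, ?_⟩
    have : e w = d w := by simp [e]
    rw [this]
    exact sq_pos_of_ne_zero hw
  have : 0 < 2 * t ^ 2 * ∑ v, e v ^ 2 := by positivity
  linarith

/-- Two linear forms can be balanced by signs up to the weight of at most two coordinates. -/
theorem exists_sign_balancing {V : Type} [Fintype V] (E : Finset V) (a b : V → ℝ) :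
    ∃ s : V → ℝ, ∃ F ⊆ E, #F ≤ 2 ∧ (∀ v ∈ E, s v = 1 ∨ s v = -1) ∧ (∀ v ∉ E, s v = 0) ∧
      |∑ v, a v * s v| ≤ ∑ v ∈ F, |a v| ∧ |∑ v, b v * s v| ≤ ∑ v ∈ F, |b v| := by
  classical
  obtain ⟨p, hp1, hp2, hp3, hp4, hcard⟩ := exists_annihilating_almost_vertex E a b
  let s : V → ℝ := fun v => if v ∈ E then (if 0 ≤ p v then 1 else -1) else 0
  set F := {v ∈ E | |p v| ≠ 1} with hF
  have hs : ∀ v ∉ F, s v = p v := by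
    intro v hv
    by_cases hE : v ∈ E
    · have h1 : |p v| = 1 := by by_contra h; exact hv (Finset.mem_filter.2 ⟨hE, h⟩)
      rcases eq_or_eq_neg_of_abs_eq h1 with h | h <;> simp [s, hE, h]
    · simp [s, hE, hp2 v hE]
  have hs1 : ∀ v ∈ F, |s v - p v| ≤ 1 := by
    intro v hv
    have hE := (Finset.mem_filter.1 hv).1
    have := abs_le.1 (hp1 v)
    simp only [s, hE, if_true]
    split_ifs with h <;> rw [abs_le] <;> constructor <;> linarith
  have key : ∀ c : V → ℝ, ∑ v, c v * p v = 0 → |∑ v, c v * s v| ≤ ∑ v ∈ F, |c v| := by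
    intro c hc
    have : ∑ v, c v * s v = ∑ v ∈ F, c v * (s v - p v) := by
      rw [Finset.sum_subset (Finset.subset_univ F) (by intro v _ hv; simp [hs v hv]),
        ← sub_zero (∑ v, c v * s v), ← hc, ← Finset.sum_sub_distrib]
      exact Finset.sum_congr rfl fun v _ => by ring
    rw [this]
    refine (Finset.abs_sum_le_sum_abs _ _).trans (Finset.sum_le_sum fun v hv => ?_)
    rw [abs_mul]
    exact mul_le_of_le_one_right (abs_nonneg _) (hs1 v hv)
  refine ⟨s, F, Finset.filter_subset _ _, hcard, fun v hv => ?_, fun v hv => by simp [s, hv],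
    key a hp3, key b hp4⟩
  simp only [s, hv, if_true]
  split_ifs <;> simp

/-! ### One deduction step at a half-integral point -/

/-- All coordinates are `0`, `1/2` or `1`. -/
def IsHalfIntegral {V : Type} (z : V → ℝ) : Prop :=
  ∀ v, z v = 0 ∨ z v = 1 / 2 ∨ z v = 1

/-- `w` arises from `z` by changing some coordinates equal to `1/2`. -/
def Extends {V : Type} (z w : V → ℝ) : Prop :=
  ∀ v, z v ≠ 1 / 2 → w v = z v

/-- The inequality holds at the midpoint of two points at which it holds. -/
theorem LinIneq.Holds.midpoint {V : Type} [Fintype V] {I : LinIneq V} {u w z : V → ℝ}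
    (hu : I.Holds u) (hw : I.Holds w) (h : ∀ v, z v = (u v + w v) / 2) : I.Holds z := by
  unfold LinIneq.Holds at *
  have : ∑ v, I.coeff v * z v = (∑ v, I.coeff v * u v + ∑ v, I.coeff v * w v) / 2 := by
    rw [← Finset.sum_add_distrib, Finset.sum_div]
    exact Finset.sum_congr rfl fun v _ => by rw [h]; ring
  linarith

/-- A semantic deduction is valid at a half-integral point `z` if its premises hold at all points
obtained by rounding at most two of the coordinates of `z` equal to `1/2`. -/
theorem holds_of_holds_two_rounded {V : Type} [Fintype V] {I J K : LinIneq V}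
    (sound : ∀ z : V → ℝ, IsBoolean z → J.Holds z → K.Holds z → I.Holds z)
    {z : V → ℝ} (hz : IsHalfIntegral z)
    (hround : ∀ F : Finset V, #F ≤ 2 → (∀ v ∈ F, z v = 1 / 2) → ∀ w : V → ℝ,
      (∀ v ∉ F, w v = z v) → (∀ v ∈ F, w v = 0 ∨ w v = 1) → J.Holds w ∧ K.Holds w) :
    I.Holds z := by
  classical
  set E : Finset V := {v | z v = 1 / 2} with hE
  obtain ⟨s, F, hFE, hF2, hs1, hs0, ha, hb⟩ := exists_sign_balancing E J.coeff K.coeff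
  have hzF : ∀ v ∈ F, z v = 1 / 2 := fun v hv => by simpa [hE] using hFE hv
  have hFs : ∀ c : V → ℝ, |∑ v, c v * s v| ≤ ∑ v ∈ F, |c v| → ∀ β : ℝ,
      (∀ w : V → ℝ, (∀ v ∉ F, w v = z v) → (∀ v ∈ F, w v = 0 ∨ w v = 1) →
        β ≤ ∑ v, c v * w v) → ∀ σ : ℝ, |σ| = 1 → β ≤ ∑ v, c v * (z v + σ * s v / 2) := by
    intro c hc β hβ σ hσ
    -- The rounding on `F` that is worst for `c` lowers the form by exactly half of `∑ v ∈ F, |c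
    -- v|`, which is the most that moving by `σ * s / 2` can lower it.
    have h1 := hβ (fun v => if v ∈ F then (if 0 ≤ c v then 0 else 1) else z v)
      (fun v hv => by simp [hv]) (fun v hv => by simp only [hv, if_true]; split_ifs <;> simp)
    have h2 : ∑ v, c v * (if v ∈ F then (if 0 ≤ c v then (0 : ℝ) else 1) else z v) =
        ∑ v, c v * z v - (∑ v ∈ F, |c v|) / 2 := by
      have : ∑ v ∈ F, |c v| = ∑ v, if v ∈ F then |c v| else 0 := by simp
      rw [this, Finset.sum_div, ← Finset.sum_sub_distrib]
      refine Finset.sum_congr rfl fun v _ => ?_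
      by_cases hv : v ∈ F
      · simp only [hv, if_true, hzF v hv]
        split_ifs with h
        · rw [abs_of_nonneg h]; ring
        · rw [abs_of_neg (not_le.1 h)]; ring
      · simp [hv]
    have h3 : ∑ v, c v * (z v + σ * s v / 2) = ∑ v, c v * z v + σ * (∑ v, c v * s v) / 2 := by
      rw [Finset.mul_sum, Finset.sum_div, ← Finset.sum_add_distrib]
      exact Finset.sum_congr rfl fun v _ => by ring
    have h4 : |σ * ∑ v, c v * s v| ≤ ∑ v ∈ F, |c v| := by rwa [abs_mul, hσ, one_mul]
    have := (abs_le.1 h4).1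
    rw [h3]
    rw [h2] at h1
    linarith
  have hbool : ∀ σ : ℝ, |σ| = 1 → IsBoolean fun v => z v + σ * s v / 2 := by
    intro σ hσ v
    show z v + σ * s v / 2 = 0 ∨ z v + σ * s v / 2 = 1
    by_cases hv : z v = 1 / 2
    · have := hs1 v (by simp [hE, hv])
      rcases eq_or_eq_neg_of_abs_eq hσ with rfl | rfl <;> rcases this with h | h <;>
        rw [hv, h] <;> norm_num
    · rw [hs0 v (by simpa [hE] using hv)]
      rcases hz v with h | h | h
      · simp [h]
      · exact absurd h hv
      · simp [h]
  have hI : ∀ σ : ℝ, |σ| = 1 → I.Holds fun v => z v + σ * s v / 2 := fun σ hσ =>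
    sound _ (hbool σ hσ)
      (hFs J.coeff ha _ (fun w h1 h2 => (hround F hF2 hzF w h1 h2).1) σ hσ)
      (hFs K.coeff hb _ (fun w h1 h2 => (hround F hF2 hzF w h1 h2).2) σ hσ)
  exact (hI 1 (by simp)).midpoint (hI (-1) (by simp)) fun v => by ring

/-! ### Unique neighbours and expansion -/

/-- The elements that lie in exactly one of the sets `S i`, `i ∈ T`. -/
def uniqueNbrs {X ι : Type} [DecidableEq X] (S : ι → Finset X) (T : Finset ι) : Finset X :=
  {v ∈ T.biUnion S | #{i ∈ T | v ∈ S i} = 1}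

section Expansion

variable {X ι : Type} [DecidableEq X] {S : ι → Finset X}

theorem exists_unique_of_mem_uniqueNbrs {T : Finset ι} {v : X} (hv : v ∈ uniqueNbrs S T) :
    ∃ i ∈ T, v ∈ S i ∧ ∀ j ∈ T, v ∈ S j → j = i := by
  obtain ⟨i, hi⟩ := Finset.card_eq_one.1 (Finset.mem_filter.1 hv).2
  have hi' : i ∈ ({i ∈ T | v ∈ S i} : Finset ι) := by simp [hi]
  refine ⟨i, (Finset.mem_filter.1 hi').1, (Finset.mem_filter.1 hi').2, fun j hj hvj => ?_⟩
  have : j ∈ ({i ∈ T | v ∈ S i} : Finset ι) := by simp [hj, hvj]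
  simpa [hi] using this

theorem mem_uniqueNbrs_of_unique {T : Finset ι} {v : X} {i : ι} (hi : i ∈ T) (hv : v ∈ S i)
    (h : ∀ j ∈ T, v ∈ S j → j = i) : v ∈ uniqueNbrs S T := by
  refine Finset.mem_filter.2 ⟨Finset.mem_biUnion.2 ⟨i, hi, hv⟩, Finset.card_eq_one.2 ⟨i, ?_⟩⟩
  ext j
  simp only [Finset.mem_filter, Finset.mem_singleton]
  exact ⟨fun hj => h j hj.1 hj.2, fun hj => hj ▸ ⟨hi, hv⟩⟩

theorem uniqueNbrs_singleton (i : ι) : uniqueNbrs S {i} = S i := by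
  ext v
  refine ⟨fun hv => ?_, fun hv => mem_uniqueNbrs_of_unique (Finset.mem_singleton_self i) hv
    fun j hj _ => Finset.mem_singleton.1 hj⟩
  simpa using (Finset.mem_filter.1 hv).1

/-- The single set containing `v` lies in `T` if `T` covers `v`, and in `U` otherwise. This makes
density additive when a closure is enlarged. -/
theorem uniqueNbrs_union_sdiff_subset [DecidableEq ι] (A : Finset X) (T U : Finset ι) :
    uniqueNbrs S (T ∪ U) \ A ⊆ (uniqueNbrs S T \ A) ∪ (uniqueNbrs S U \ (A ∪ T.biUnion S)) := by
  intro v hv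
  obtain ⟨hv, hA⟩ := Finset.mem_sdiff.1 hv
  obtain ⟨i, hi, hvi, huniq⟩ := exists_unique_of_mem_uniqueNbrs hv
  by_cases hT : v ∈ T.biUnion S
  · obtain ⟨j, hj, hvj⟩ := Finset.mem_biUnion.1 hT
    have hiT : i ∈ T := huniq j (Finset.mem_union_left _ hj) hvj ▸ hj
    exact Finset.mem_union_left _ (Finset.mem_sdiff.2 ⟨mem_uniqueNbrs_of_unique hiT hvi
      fun j hj => huniq j (Finset.mem_union_left _ hj), hA⟩)
  · have hiU : i ∈ U := (Finset.mem_union.1 hi).resolve_left fun h =>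
      hT (Finset.mem_biUnion.2 ⟨i, h, hvi⟩)
    refine Finset.mem_union_right _ (Finset.mem_sdiff.2 ⟨mem_uniqueNbrs_of_unique hiU hvi
      fun j hj => huniq j (Finset.mem_union_right _ hj), ?_⟩)
    simp only [Finset.mem_union, not_or]
    exact ⟨hA, hT⟩

/-- Double counting of incidences: there are `k * #T` of them, and every covered element that is not
a unique neighbour accounts for at least two. -/
theorem two_mul_card_biUnion_le {k : ℕ} (hS : ∀ i, #(S i) = k) (T : Finset ι) :
    2 * #(T.biUnion S) ≤ #(uniqueNbrs S T) + k * #T := by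
  have h1 : ∑ v ∈ T.biUnion S, #{i ∈ T | v ∈ S i} = k * #T := by
    have := Finset.sum_card_bipartiteAbove_eq_sum_card_bipartiteBelow (s := T) (t := T.biUnion S)
      (fun i v => v ∈ S i)
    simp only [Finset.bipartiteAbove, Finset.bipartiteBelow] at this
    rw [← this, Finset.sum_congr rfl fun i hi => ?_, Finset.sum_const, smul_eq_mul, mul_comm]
    rw [← hS i]
    congr 1
    ext v
    simp only [Finset.mem_filter, Finset.mem_biUnion]
    exact ⟨fun h => h.2, fun h => ⟨⟨i, hi, h⟩, h⟩⟩
  have h2 : #(uniqueNbrs S T) = ∑ v ∈ T.biUnion S, if #{i ∈ T | v ∈ S i} = 1 then 1 else 0 := by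
    rw [uniqueNbrs, Finset.card_filter]
  rw [← h1, h2, ← Finset.sum_add_distrib, mul_comm, ← smul_eq_mul, ← Finset.sum_const]
  refine Finset.sum_le_sum fun v hv => ?_
  obtain ⟨i, hi, hvi⟩ := Finset.mem_biUnion.1 hv
  have : 0 < #{i ∈ T | v ∈ S i} := Finset.card_pos.2 ⟨i, by simp [hi, hvi]⟩
  split_ifs with h <;> omega

/-- Any `r` of the sets, or fewer, have a union of size at least `k - 5/4` times their number. -/
def IsExpanding (S : ι → Finset X) (k r : ℕ) : Prop :=
  ∀ T : Finset ι, #T ≤ r → (4 * k - 5) * #T ≤ 4 * #(T.biUnion S)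

/-- A set of constraints has few unique neighbours outside `A`. -/
def IsDense (S : ι → Finset X) (A : Finset X) (T : Finset ι) : Prop :=
  #(uniqueNbrs S T \ A) ≤ 3 * #T

/-- Expansion gives `2 * (k - 5/4) - k = k - 5/2` unique neighbours per set. For `k ≥ 6` this is at
least `7/2`, which exceeds the density threshold `3`. -/
theorem IsExpanding.seven_mul_card_le {k r : ℕ} (hexp : IsExpanding S k r) (hk : 6 ≤ k)
    (hS : ∀ i, #(S i) = k) {T : Finset ι} (hT : #T ≤ r) : 7 * #T ≤ 2 * #(uniqueNbrs S T) := by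
  have h1 := hexp T hT
  have h2 := two_mul_card_biUnion_le hS T
  obtain ⟨l, rfl⟩ := Nat.exists_eq_add_of_le hk
  have h3 : 4 * (6 + l) - 5 = 19 + 4 * l := by omega
  rw [h3] at h1
  nlinarith [Nat.zero_le (l * #T)]

/-- The surplus of `1/2` unique neighbour per set over the threshold `3` must lie inside `A`. -/
theorem IsExpanding.card_le_of_isDense {k r : ℕ} (hexp : IsExpanding S k r) (hk : 6 ≤ k)
    (hS : ∀ i, #(S i) = k) {T : Finset ι} (hT : #T ≤ r) {A : Finset X} (hd : IsDense S A T) :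
    #T ≤ 2 * #A := by
  have h1 := hexp.seven_mul_card_le hk hS hT
  have h2 := Finset.le_card_sdiff A (uniqueNbrs S T)
  unfold IsDense at hd
  omega

/-- `T` is a maximal dense set of at most `R` constraints. -/
def IsClosure (S : ι → Finset X) (R : ℕ) (A : Finset X) (T : Finset ι) : Prop :=
  Maximal (fun T => #T ≤ R ∧ IsDense S A T) T

/-- Sets of constraints outside a closure have many unique neighbours outside the variables
covered by it. -/
theorem IsClosure.lt_card_uniqueNbrs [DecidableEq ι] {k R : ℕ} (hexp : IsExpanding S k (2 * R)) (hk : 6 ≤ k)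
    (hS : ∀ i, #(S i) = k) {A : Finset X} {T U : Finset ι} (hT : IsClosure S R A T)
    (hA : 2 * #A ≤ R) (hU : U.Nonempty) (hUR : #U ≤ R) (hTU : Disjoint T U) :
    3 * #U < #(uniqueNbrs S U \ (A ∪ T.biUnion S)) := by
  by_contra! h
  have hcard : #(T ∪ U) = #T + #U := Finset.card_union_of_disjoint hTU
  have hTR := hT.prop.1
  have hTd : #(uniqueNbrs S T \ A) ≤ 3 * #T := hT.prop.2
  have hd : IsDense S A (T ∪ U) := by
    have h1 := (Finset.card_le_card (uniqueNbrs_union_sdiff_subset (S := S) A T U)).trans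
      (Finset.card_union_le _ _)
    unfold IsDense
    omega
  -- The union may have up to `2 * R` elements, which is why expansion is assumed that far. Being
  -- dense, it has at most `2 * #A ≤ R`, so it competes with the maximal `T`.
  have hle := hexp.card_le_of_isDense hk hS (by omega) hd
  have hsub : T ∪ U ⊆ T := hT.le_of_ge ⟨by omega, hd⟩ Finset.subset_union_left
  obtain ⟨u, hu⟩ := hU
  exact Finset.disjoint_right.1 hTU hu (hsub (Finset.mem_union_right _ hu))

end Expansion

/-! ### Rounding half-integral points to satisfy equations mod 2 -/

/-- The value mod 2 of a coordinate of a `{0,1}`-point. -/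
noncomputable def bitOf (t : ℝ) : ZMod 2 := if t = 1 then 1 else 0

/-- A property of points closed under taking midpoints. -/
def MidConvex {X : Type} (P : (X → ℝ) → Prop) : Prop :=
  ∀ u w z : X → ℝ, P u → P w → (∀ v, z v = (u v + w v) / 2) → P z

section Rounding

variable {X : Type}

theorem Extends.trans {z w u : X → ℝ} (h1 : Extends z w) (h2 : Extends w u) : Extends z u :=
  fun v hv => by rw [h2 v (by rwa [h1 v hv]), h1 v hv]

/-- `w` rounds exactly those `1/2`-coordinates of `z` that lie in `D`. -/
structure RoundsOn (D : Finset X) (z w : X → ℝ) : Prop where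
  ext : Extends z w
  half : IsHalfIntegral w
  free : ∀ v, w v = 1 / 2 ↔ z v = 1 / 2 ∧ v ∉ D

theorem RoundsOn.trans [DecidableEq X] {D D' : Finset X} {z w u : X → ℝ} (h1 : RoundsOn D z w)
    (h2 : RoundsOn D' w u) : RoundsOn (D ∪ D') z u where
  ext := h1.ext.trans h2.ext
  half := h2.half
  free v := by rw [h2.free, h1.free, Finset.mem_union]; tauto

theorem roundsOn_update [DecidableEq X] {z : X → ℝ} (hz : IsHalfIntegral z) {f : X} (hf : z f = 1 / 2) {c : ℝ}
    (hc : c = 0 ∨ c = 1) : RoundsOn {f} z (Function.update z f c) where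
  ext v hv := Function.update_of_ne (by rintro rfl; exact hv hf) _ _
  half v := by
    by_cases h : v = f
    · subst h; rcases hc with rfl | rfl <;> simp
    · rw [Function.update_of_ne h]; exact hz v
  free v := by
    by_cases h : v = f
    · subst h; rcases hc with rfl | rfl <;> simp
    · rw [Function.update_of_ne h]; simp [h]

theorem MidConvex.of_update [DecidableEq X] {P : (X → ℝ) → Prop} (hP : MidConvex P) {z : X → ℝ} {f : X}
    (hf : z f = 1 / 2) (h0 : P (Function.update z f 0)) (h1 : P (Function.update z f 1)) : P z := by
  refine hP _ _ z h0 h1 fun v => ?_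
  by_cases h : v = f
  · subst h; simp [hf]
  · simp [Function.update_of_ne h]

/-- If at least two variables of an equation mod 2 are free, then a half-integral point is in the
convex hull of its roundings satisfying the equation. -/
theorem MidConvex.of_roundsOn_equation [DecidableEq X] {P : (X → ℝ) → Prop} (hP : MidConvex P) (S : Finset X)
    (b : ZMod 2) : ∀ z : X → ℝ, IsHalfIntegral z → 2 ≤ #{v ∈ S | z v = 1 / 2} →
      (∀ w, RoundsOn S z w → ∑ v ∈ S, bitOf (w v) = b → P w) → P z := by
  suffices H : ∀ (c : ℕ) (z : X → ℝ), IsHalfIntegral z → #{v ∈ S | z v = 1 / 2} = c + 2 →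
      (∀ w, RoundsOn S z w → ∑ v ∈ S, bitOf (w v) = b → P w) → P z by
    intro z hz hcard
    exact H _ z hz (Nat.sub_add_cancel hcard).symm
  intro c
  induction c with
  | zero =>
    intro z hz hcard hw
    obtain ⟨f, g, hfg, hset⟩ := Finset.card_eq_two.1 hcard
    have hf : f ∈ S ∧ z f = 1 / 2 := by
      have : f ∈ ({v ∈ S | z v = 1 / 2} : Finset X) := by rw [hset]; simp
      exact Finset.mem_filter.1 this
    have hg : g ∈ S ∧ z g = 1 / 2 := by
      have : g ∈ ({v ∈ S | z v = 1 / 2} : Finset X) := by rw [hset]; simp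
      exact Finset.mem_filter.1 this
    have hrounds : ∀ c d : ℝ, (c = 0 ∨ c = 1) → (d = 0 ∨ d = 1) →
        RoundsOn S z (Function.update (Function.update z f c) g d) := by
      intro c d hc hd
      have h1 := roundsOn_update hz hf.2 hc
      have h2 := h1.trans (roundsOn_update h1.half (f := g)
        (by rw [Function.update_of_ne hfg.symm]; exact hg.2) hd)
      refine ⟨h2.ext, h2.half, fun v => ?_⟩
      rw [h2.free]
      refine and_congr_right fun hv => not_congr ?_
      have : v ∈ S ↔ v ∈ ({v ∈ S | z v = 1 / 2} : Finset X) := by simp [hv]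
      rw [this, hset]
      simp
    let β := ∑ v ∈ (S.erase f).erase g, bitOf (z v)
    have hsum : ∀ c d : ℝ, ∑ v ∈ S, bitOf (Function.update (Function.update z f c) g d v) =
        bitOf c + bitOf d + β := by
      intro c d
      rw [← Finset.add_sum_erase S _ hf.1, ← Finset.add_sum_erase (S.erase f) _
        (Finset.mem_erase.2 ⟨hfg.symm, hg.1⟩), Function.update_of_ne hfg, Function.update_self,
        Function.update_self, add_assoc]
      congr 2
      refine Finset.sum_congr rfl fun v hv => ?_
      simp only [Finset.mem_erase] at hv
      rw [Function.update_of_ne hv.1, Function.update_of_ne hv.2.1]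
    have hbit : ∀ x : ZMod 2, x = 0 ∨ x = 1 := by decide
    have h11 : (1 : ZMod 2) + 1 = 0 := by decide
    -- The two remaining bits must agree or must differ. Either way the two solutions are
    -- complementary, so their midpoint is `z`.
    rcases hbit (b - β) with h | h
    · refine hP _ _ z (hw _ (hrounds 0 0 (by simp) (by simp)) ?_)
        (hw _ (hrounds 1 1 (by simp) (by simp)) ?_) fun v => ?_
      · rw [hsum]; simp [bitOf]; exact (sub_eq_zero.1 h).symm
      · rw [hsum]; simp [bitOf, h11]; exact (sub_eq_zero.1 h).symm
      · by_cases hvg : v = g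
        · subst hvg; simp [hg.2]
        · by_cases hvf : v = f
          · subst hvf; simp [hf.2, hvg]
          · simp [hvg, hvf]
    · have hb : b = 1 + β := by rw [← h]; ring
      refine hP _ _ z (hw _ (hrounds 0 1 (by simp) (by simp)) ?_)
        (hw _ (hrounds 1 0 (by simp) (by simp)) ?_) fun v => ?_
      · rw [hsum]; simp [bitOf, hb]
      · rw [hsum]; simp [bitOf, hb]
      · by_cases hvg : v = g
        · subst hvg; simp [hg.2]
        · by_cases hvf : v = f
          · subst hvf; simp [hf.2, hvg]
          · simp [hvg, hvf]
  | succ c ih =>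
    intro z hz hcard hw
    obtain ⟨f, hf⟩ := Finset.card_pos.1 (by omega : 0 < #{v ∈ S | z v = 1 / 2})
    obtain ⟨hfS, hfz⟩ := Finset.mem_filter.1 hf
    have step : ∀ t : ℝ, (t = 0 ∨ t = 1) → P (Function.update z f t) := by
      intro t ht
      have h1 := roundsOn_update hz hfz ht
      refine ih _ h1.half ?_ fun w hrw hpar => hw w ?_ hpar
      · have : ({v ∈ S | Function.update z f t v = 1 / 2} : Finset X) =
            ({v ∈ S | z v = 1 / 2} : Finset X).erase f := by
          ext v
          simp only [Finset.mem_filter, Finset.mem_erase, h1.free, Finset.mem_singleton]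
          tauto
        rw [this, Finset.card_erase_of_mem hf, hcard]
        omega
      · have := h1.trans hrw
        rwa [Finset.union_eq_right.2 (Finset.singleton_subset_iff.2 hfS)] at this
    exact hP.of_update hfz (step 0 (by simp)) (step 1 (by simp))

/-- A point with values off `1/2` keeps them under rounding. -/
theorem Extends.sum_bitOf_eq {z w : X → ℝ} (h : Extends z w) {S : Finset X}
    (hS : ∀ v ∈ S, z v ≠ 1 / 2) : ∑ v ∈ S, bitOf (w v) = ∑ v ∈ S, bitOf (z v) :=
  Finset.sum_congr rfl fun v hv => by rw [h v (hS v hv)]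

/-- If every nonempty subsystem has, on average, two free unique neighbours per equation, then a
half-integral point is in the convex hull of its roundings satisfying the system. -/
theorem MidConvex.of_roundsOn_system [DecidableEq X] {ι : Type} [DecidableEq ι] {P : (X → ℝ) → Prop}
    (hP : MidConvex P) (S : ι → Finset X) (b : ι → ZMod 2) {z : X → ℝ} (hz : IsHalfIntegral z) :
    ∀ T : Finset ι, (∀ U ⊆ T, U.Nonempty → 2 * #U ≤ #{v ∈ uniqueNbrs S U | z v = 1 / 2}) →
      (∀ w, RoundsOn (T.biUnion S) z w → (∀ i ∈ T, ∑ v ∈ S i, bitOf (w v) = b i) → P w) → P z := by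
  intro T
  induction hc : #T generalizing T P with
  | zero =>
    intro _ hw
    rw [Finset.card_eq_zero] at hc
    subst hc
    exact hw z ⟨fun _ _ => rfl, hz, by simp⟩ (by simp)
  | succ c ih =>
    intro hU hw
    have hne : T.Nonempty := Finset.card_pos.1 (by omega)
    -- By pigeonhole some equation `t` owns two free unique neighbours. The other equations are
    -- solved without touching these, so `t` can be solved last.
    obtain ⟨t, htT, ht⟩ : ∃ t ∈ T, 2 ≤ #{v ∈ uniqueNbrs S T | z v = 1 / 2 ∧ v ∈ S t} := by
      by_contra! h
      have h1 := hU T subset_rfl hne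
      have h2 : ({v ∈ uniqueNbrs S T | z v = 1 / 2} : Finset X) ⊆
          T.biUnion fun t => {v ∈ uniqueNbrs S T | z v = 1 / 2 ∧ v ∈ S t} := by
        intro v hv
        obtain ⟨hv1, hv2⟩ := Finset.mem_filter.1 hv
        obtain ⟨i, hi, hvi, -⟩ := exists_unique_of_mem_uniqueNbrs hv1
        exact Finset.mem_biUnion.2 ⟨i, hi, Finset.mem_filter.2 ⟨hv1, hv2, hvi⟩⟩
      have h3 := (Finset.card_le_card h2).trans
        (Finset.card_biUnion_le_card_mul T _ 1 fun t ht => by have := h t ht; omega)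
      omega
    refine ih hP (T.erase t) (by rw [Finset.card_erase_of_mem htT, hc]; rfl)
      (fun U hUT => hU U (hUT.trans (Finset.erase_subset _ _))) fun w hrw hpar => ?_
    refine hP.of_roundsOn_equation (S t) (b t) w hrw.half (ht.trans (Finset.card_le_card ?_))
      fun u hru hput => ?_
    · intro v hv
      obtain ⟨hv1, hv2, hv3⟩ := Finset.mem_filter.1 hv
      refine Finset.mem_filter.2 ⟨hv3, (hrw.free v).2 ⟨hv2, fun hmem => ?_⟩⟩
      obtain ⟨j, hj, hvj⟩ := Finset.mem_biUnion.1 hmem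
      obtain ⟨i, -, -, huniq⟩ := exists_unique_of_mem_uniqueNbrs hv1
      have hji := huniq j (Finset.mem_of_mem_erase hj) hvj
      have hti := huniq t htT hv3
      exact (Finset.mem_erase.1 hj).1 (hji.trans hti.symm)
    · refine hw u ?_ fun i hi => ?_
      · have := hrw.trans hru
        rwa [show (T.erase t).biUnion S ∪ S t = T.biUnion S by
          conv_rhs => rw [← Finset.insert_erase htT, Finset.biUnion_insert]
          rw [Finset.union_comm]] at this
      · by_cases hit : i = t
        · rw [hit]; exact hput
        · have hiT : i ∈ T.erase t := Finset.mem_erase.2 ⟨hit, hi⟩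
          rw [hru.ext.sum_bitOf_eq fun v hv hv2 =>
            ((hrw.free v).1 hv2).2 (Finset.mem_biUnion.2 ⟨i, hiT, hv⟩)]
          exact hpar i hiT

end Rounding

/-! ### Half-integral points that survive many rounds -/

theorem XClause.ineq_holds_iff {n m : ℕ} (C : XClause n) (i : Fin m) (z : Fin n ⊕ Fin m → ℝ) :
    (C.ineq i).Holds z ↔
      z (.inr i) ≤ ∑ j ∈ C.pos, z (.inl j) + ∑ j ∈ C.neg, (1 - z (.inl j)) := by
  simp only [LinIneq.Holds, XClause.ineq, Fintype.sum_sum_type, Sum.elim_inl, Sum.elim_inr,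
    sub_mul, ite_mul, one_mul, zero_mul, neg_mul, Finset.sum_sub_distrib, Finset.sum_ite_mem,
    Finset.univ_inter, Finset.sum_ite_eq', Finset.mem_univ, if_true,
    Finset.sum_const, nsmul_eq_mul, mul_one]
  constructor <;> intro h <;> linarith

theorem lowerIneq_holds_iff {V : Type} [Fintype V] [DecidableEq V] (v : V) (z : V → ℝ) :
    (lowerIneq v).Holds z ↔ 0 ≤ z v := by
  simp [LinIneq.Holds, lowerIneq]

theorem upperIneq_holds_iff {V : Type} [Fintype V] [DecidableEq V] (v : V) (z : V → ℝ) :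
    (upperIneq v).Holds z ↔ z v ≤ 1 := by
  simp [LinIneq.Holds, upperIneq]

/-- The half-integral point `z` is integral exactly on the set `A` and the variables of the
constraints in `T`, which it satisfies, and `T` is a closure of `A`. -/
structure IsProtected {X ι : Type} [DecidableEq X] (S : ι → Finset X) (b : ι → ZMod 2) (R : ℕ)
    (A : Finset X) (T : Finset ι) (z : X → ℝ) : Prop where
  half : IsHalfIntegral z
  free : ∀ v, z v = 1 / 2 ↔ v ∉ A ∪ T.biUnion S
  parity : ∀ i ∈ T, ∑ v ∈ S i, bitOf (z v) = b i
  closure : IsClosure S R A T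

/-- The conditions on a system of equations mod 2 under which protected points exist. -/
structure IsRobust {X ι : Type} [DecidableEq X] (S : ι → Finset X) (k R : ℕ) : Prop where
  six_le : 6 ≤ k
  card_eq : ∀ i, #(S i) = k
  expanding : IsExpanding S k (2 * R)

/-- The starting point of the iteration. A dense set for `A = ∅` has at most `2 * 0` elements, so
the empty closure is maximal. -/
theorem isProtected_half {X ι : Type} [DecidableEq X] {S : ι → Finset X} {k R : ℕ}
    (hS : IsRobust S k R) (b : ι → ZMod 2) : IsProtected S b R ∅ ∅ fun _ => 1 / 2 where
  half _ := by simp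
  free v := by simp
  parity := by simp
  closure := by
    refine ⟨by simp [IsDense, uniqueNbrs], fun T hT _ => ?_⟩
    have := hS.expanding.card_le_of_isDense hS.six_le hS.card_eq (by have := hT.1; omega) hT.2
    simpa using this

section Protected

variable {X ι : Type} [DecidableEq X] [DecidableEq ι] {S : ι → Finset X} {b : ι → ZMod 2} {k R : ℕ}

/-- A point obtained from a protected point by rounding at most two coordinates is in the convex
hull of protected points. -/
theorem IsProtected.midConvex_of_rounded [Finite ι] (hS : IsRobust S k R) {A : Finset X}
    {T : Finset ι}
    {z : X → ℝ} (hz : IsProtected S b R A T z) {F : Finset X} (hF : #F ≤ 2)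
    (hA : 2 * #A ≤ R) {w : X → ℝ} (hw : RoundsOn F z w)
    {P : (X → ℝ) → Prop} (hP : MidConvex P)
    (h : ∀ T' u, IsProtected S b R (A ∪ F) T' u → P u) : P w := by
  -- Density only gets easier as `A` grows, so some closure `T'` of `A ∪ F` contains `T`, and only
  -- the equations of `T' \ T` remain to be solved.
  have hdense : IsDense S (A ∪ F) T := by
    have h1 : #(uniqueNbrs S T \ A) ≤ 3 * #T := hz.closure.prop.2
    exact (Finset.card_le_card (Finset.sdiff_subset_sdiff subset_rfl
      Finset.subset_union_left)).trans h1
  obtain ⟨T', hTT', hT'⟩ := Set.Finite.exists_le_maximal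
    (Set.toFinite {T : Finset ι | #T ≤ R ∧ IsDense S (A ∪ F) T})
    (show T ∈ {T : Finset ι | #T ≤ R ∧ IsDense S (A ∪ F) T} from ⟨hz.closure.prop.1, hdense⟩)
  have hTT' : T ⊆ T' := hTT'
  refine hP.of_roundsOn_system S b hw.half (T' \ T) (fun U hU hne => ?_) fun u hu hpar => ?_
  · have hUR : #U ≤ R :=
      (Finset.card_le_card (hU.trans Finset.sdiff_subset)).trans hT'.prop.1
    have hdisj : Disjoint T U := Finset.disjoint_of_subset_right hU Finset.disjoint_sdiff
    have h1 := hz.closure.lt_card_uniqueNbrs hS.expanding hS.six_le hS.card_eq hA hne hUR hdisj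
    have h2 : (uniqueNbrs S U \ (A ∪ T.biUnion S)) \ F ⊆
        ({v ∈ uniqueNbrs S U | w v = 1 / 2} : Finset X) := by
      intro v hv
      simp only [Finset.mem_sdiff] at hv
      exact Finset.mem_filter.2 ⟨hv.1.1, (hw.free v).2 ⟨(hz.free v).2 hv.1.2, hv.2⟩⟩
    -- At least `3 * #U + 1` unique neighbours minus two in `F` leave `3 * #U - 1 ≥ 2 * #U` free
    -- ones, as `U` is nonempty.
    have h3 := Finset.card_le_card h2
    have h4 := Finset.le_card_sdiff F (uniqueNbrs S U \ (A ∪ T.biUnion S))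
    have h5 := Finset.card_pos.2 hne
    omega
  · have hzu := hw.trans hu
    refine h T' u ⟨hu.half, fun v => ?_, fun i hi => ?_, hT'⟩
    · rw [hzu.free, hz.free, ← not_or, not_iff_not]
      have : T'.biUnion S = T.biUnion S ∪ (T' \ T).biUnion S := by
        rw [← Finset.union_biUnion, Finset.union_sdiff_of_subset hTT']
      rw [this]
      simp only [Finset.mem_union]
      tauto
    · by_cases hiT : i ∈ T
      · rw [hzu.ext.sum_bitOf_eq fun v hv hv2 => (hz.free v).1 hv2
          (Finset.mem_union_right _ (Finset.mem_biUnion.2 ⟨i, hiT, hv⟩))]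
        exact hz.parity i hiT
      · exact hpar i (Finset.mem_sdiff.2 ⟨hi, hiT⟩)

/-- A constraint that is not satisfied outright at a protected point has two free variables. -/
theorem IsProtected.two_le_card_free (hS : IsRobust S k R) (hR : 1 ≤ R) {A : Finset X}
    {T : Finset ι} {z : X → ℝ} (hz : IsProtected S b R A T z) (hA : 2 * #A ≤ R) {i : ι}
    (hi : i ∉ T) : 2 ≤ #{v ∈ S i | z v = 1 / 2} := by
  have h1 := hz.closure.lt_card_uniqueNbrs hS.expanding hS.six_le hS.card_eq hA
    (Finset.singleton_nonempty i) (by simpa using hR) (by simpa using hi)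
  rw [uniqueNbrs_singleton, Finset.card_singleton] at h1
  have h2 : S i \ (A ∪ T.biUnion S) ⊆ ({v ∈ S i | z v = 1 / 2} : Finset X) := by
    intro v hv
    rw [Finset.mem_sdiff] at hv
    exact Finset.mem_filter.2 ⟨hv.1, (hz.free v).2 hv.2⟩
  have := Finset.card_le_card h2
  omega

/-- A protected point satisfies the linear form of each clause implied by a constraint. -/
theorem IsProtected.one_le_clause (hS : IsRobust S k R) (hR : 1 ≤ R) {A : Finset X}
    {T : Finset ι} {z : X → ℝ} (hz : IsProtected S b R A T z) (hA : 2 * #A ≤ R) (i : ι)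
    {N : Finset X} (hN : N ⊆ S i) (hNb : (#N : ZMod 2) ≠ b i) :
    1 ≤ ∑ v ∈ S i \ N, z v + ∑ v ∈ N, (1 - z v) := by
  let f : X → ℝ := fun v => if v ∈ N then 1 - z v else z v
  have hsum : ∑ v ∈ S i \ N, z v + ∑ v ∈ N, (1 - z v) = ∑ v ∈ S i, f v := by
    rw [← Finset.sum_sdiff hN]
    congr 1
    · exact Finset.sum_congr rfl fun v hv => by simp [f, (Finset.mem_sdiff.1 hv).2]
    · exact Finset.sum_congr rfl fun v hv => by simp [f, hv]
  have hf0 : ∀ v, 0 ≤ f v := by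
    intro v
    simp only [f]
    rcases hz.half v with h | h | h <;> rw [h] <;> split_ifs <;> norm_num
  rw [hsum]
  by_cases hi : i ∈ T
  · have hbool : ∀ v ∈ S i, z v = 0 ∨ z v = 1 := by
      intro v hv
      rcases hz.half v with h | h | h
      · exact .inl h
      · exact absurd (Finset.mem_union_right _ (Finset.mem_biUnion.2 ⟨i, hi, hv⟩)) ((hz.free v).1 h)
      · exact .inr h
    obtain ⟨v, hv, hfv⟩ : ∃ v ∈ S i, f v = 1 := by
      -- Otherwise every literal is false, so `N` is the set of ones in `S i` and the satisfied
      -- equation forces `#N = b i` mod 2.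
      by_contra! hne
      apply hNb
      rw [← hz.parity i hi]
      have : ({v ∈ S i | z v = 1} : Finset X) = N := by
        ext v
        rw [Finset.mem_filter]
        refine ⟨fun ⟨hv, h1⟩ => ?_, fun hv => ⟨hN hv, ?_⟩⟩
        · by_contra hvN
          exact hne v hv (by simp [f, hvN, h1])
        · rcases hbool v (hN hv) with h | h
          · exact absurd (by simp [f, hv, h]) (hne v (hN hv))
          · exact h
      rw [← this]
      simp [bitOf]
    exact hfv ▸ Finset.single_le_sum (fun v _ => hf0 v) hv
  -- Each free variable contributes `1/2` to the linear form, whatever its sign.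
  · have h2 := hz.two_le_card_free hS hR hA hi
    calc (1 : ℝ) ≤ #{v ∈ S i | z v = 1 / 2} * (1 / 2) := by
          have : (2 : ℝ) ≤ #{v ∈ S i | z v = 1 / 2} := by exact_mod_cast h2
          linarith
      _ = ∑ v ∈ S i with z v = 1 / 2, f v := by
          rw [Finset.sum_congr rfl fun v hv => ?_, Finset.sum_const, nsmul_eq_mul]
          have := (Finset.mem_filter.1 hv).2
          simp only [f, this]
          split_ifs <;> norm_num
      _ ≤ ∑ v ∈ S i, f v :=
          Finset.sum_le_sum_of_subset_of_nonneg (Finset.filter_subset _ _) fun v _ _ => hf0 v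

end Protected

/-- Protected points, with all `y_i = 1`, satisfy all inequalities of small depth. -/
theorem IsProtected.holds {n m k R a : ℕ} {e : Fin m → KXor n k}
    {enc : Fin m → Set (XClause n)} (henc : ∀ i, enc i ⊆ (e i).clauses)
    (hS : IsRobust (fun i => (e i).1.1) k R) (hR : 1 ≤ R) (ha : 2 * a ≤ R) {d : ℕ}
    {I : LinIneq (Fin n ⊕ Fin m)} (hI : SCPDerives (maxLP enc).constraints d I) :
    ∀ (A : Finset (Fin n)) (T : Finset (Fin m)) (z : Fin n → ℝ), #A + 2 * d ≤ a →
      IsProtected (fun i => (e i).1.1) (fun i => (e i).2) R A T z →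
      I.Holds (Sum.elim z fun _ => 1) := by
  induction hI with
  | hyp d I hI =>
    intro A T z hA hz
    rcases hI with ⟨i, C, hC, rfl⟩ | ⟨v, rfl | rfl⟩
    · obtain ⟨N, hN, hNb, rfl⟩ := henc i hC
      rw [XClause.ineq_holds_iff]
      exact hz.one_le_clause hS hR (by omega) i hN hNb
    · rw [lowerIneq_holds_iff]
      rcases v with v | v
      · rcases hz.half v with h | h | h <;> simp [h]
      · simp
    · rw [upperIneq_holds_iff]
      rcases v with v | v
      · rcases hz.half v with h | h | h <;> simp [h]
        norm_num
      · simp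
  | deduce d J K I hJ hK sound ihJ ihK =>
    intro A T z hA hz
    refine holds_of_holds_two_rounded sound ?_ fun F hF hF2 w hw1 hw2 => ?_
    · rintro (v | v)
      · exact hz.half v
      · simp
    · let F' : Finset (Fin n) := {v | Sum.inl v ∈ F}
      have hF' : #F' ≤ 2 := by
        refine le_trans ?_ hF
        refine Finset.card_le_card_of_injOn Sum.inl (fun v hv => ?_) Sum.inl_injective.injOn
        simpa [F'] using hv
      -- The `y` coordinates equal `1`, never `1/2`, so they are not rounded and all the work
      -- concerns the `x` coordinates.
      have hinr : ∀ i : Fin m, w (.inr i) = 1 := by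
        intro i
        have : Sum.inr i ∉ F := fun h => by have := hF2 _ h; norm_num at this
        rw [hw1 _ this]; rfl
      have hweq : w = Sum.elim (fun v => w (.inl v)) fun _ => 1 := by
        ext (v | v)
        · rfl
        · exact hinr v
      have hround : RoundsOn F' z fun v => w (.inl v) := by
        have hnot : ∀ v, Sum.inl v ∉ F → w (.inl v) = z v := fun v hv => hw1 _ hv
        refine ⟨fun v hv => hnot v fun h => hv (hF2 _ h), fun v => ?_, fun v => ?_⟩
        · by_cases h : Sum.inl v ∈ F
          · rcases hw2 _ h with h | h <;> simp [h]
          · show w (.inl v) = 0 ∨ w (.inl v) = 1 / 2 ∨ w (.inl v) = 1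
            rw [hnot v h]; exact hz.half v
        · by_cases h : Sum.inl v ∈ F
          · rcases hw2 _ h with h' | h' <;> simp [h', F', h]
          · simp [hnot v h, F', h]
      have hmid : ∀ L : LinIneq (Fin n ⊕ Fin m),
          MidConvex fun u : Fin n → ℝ => L.Holds (Sum.elim u fun _ => 1) := by
        intro L u w z hu hw h
        refine hu.midpoint hw ?_
        rintro (v | v)
        · exact h v
        · simp
      have hcard := Finset.card_union_le A F'
      -- The two elements added to `A` are paid for by the drop in depth: `#A + 2 * (d + 1) ≤ a`
      -- gives `#(A ∪ F') + 2 * d ≤ a`.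
      rw [hweq]
      exact ⟨hz.midConvex_of_rounded hS hF' (by omega) hround (hmid J)
          fun T' u hu => ihJ _ T' u (by omega) hu,
        hz.midConvex_of_rounded hS hF' (by omega) hround (hmid K)
          fun T' u hu => ihK _ T' u (by omega) hu⟩

/-! ### The gap -/

theorem LinProg.value_le_of_mem_feasible_maxLP {n m : ℕ} {enc : Fin m → Set (XClause n)}
    {z : Fin n ⊕ Fin m → ℝ} (hz : z ∈ (maxLP enc).feasible) : (maxLP enc).value z ≤ m := by
  have : (maxLP enc).value z = ∑ i, z (.inr i) := by
    simp [LinProg.value, maxLP, Fintype.sum_sum_type]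
  rw [this]
  calc ∑ i, z (.inr i) ≤ ∑ _i : Fin m, (1 : ℝ) := Finset.sum_le_sum fun i _ =>
        (upperIneq_holds_iff _ _).1 (hz _ (.inr ⟨_, .inr rfl⟩))
    _ = m := by simp

/-- The relaxation of a robust system does not exclude that all constraints are satisfied. -/
theorem le_optimum_scpRelaxation {n m k d : ℕ} {e : Fin m → KXor n k}
    {enc : Fin m → Set (XClause n)} (henc : ∀ i, enc i ⊆ (e i).clauses) (hd : 1 ≤ d)
    (hS : IsRobust (fun i => (e i).1.1) k (4 * d)) :
    (m : ℝ) ≤ ((maxLP enc).scpRelaxation d).optimum := by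
  refine le_csSup ⟨m, ?_⟩ ⟨Sum.elim (fun _ => 1 / 2) fun _ => 1, fun I hI => ?_, ?_⟩
  · rintro _ ⟨z, hz, rfl⟩
    exact LinProg.value_le_of_mem_feasible_maxLP (enc := enc) fun I hI => hz I (.inl hI)
  · have hI' : SCPDerives (maxLP enc).constraints d I := by
      rcases hI with hI | hI
      · exact .hyp d I hI
      · exact hI
    exact IsProtected.holds henc hS (by omega) (a := 2 * d) (by omega) hI' ∅ ∅ _ (by simp)
      (isProtected_half hS _)
  · simp [LinProg.value, LinProg.scpRelaxation, maxLP, Fintype.sum_sum_type]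

/-- The point of `{0,1}^n` given by an assignment. -/
def boolPoint {n : ℕ} (x : Fin n → Bool) (j : Fin n) : ℝ := if x j then 1 else 0

/-- The assignment satisfies the clause. -/
def XClause.Sat {n : ℕ} (C : XClause n) (x : Fin n → Bool) : Prop :=
  (∃ j ∈ C.pos, x j = true) ∨ ∃ j ∈ C.neg, x j = false

theorem XClause.one_le_iff_sat {n : ℕ} (C : XClause n) (x : Fin n → Bool) :
    1 ≤ ∑ j ∈ C.pos, boolPoint x j + ∑ j ∈ C.neg, (1 - boolPoint x j) ↔ C.Sat x := by
  have h0 : ∀ j, 0 ≤ boolPoint x j := fun j => by unfold boolPoint; split_ifs <;> norm_num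
  have h1 : ∀ j, 0 ≤ 1 - boolPoint x j := fun j => by unfold boolPoint; split_ifs <;> norm_num
  have hp : 0 ≤ ∑ j ∈ C.pos, boolPoint x j := Finset.sum_nonneg fun j _ => h0 j
  have hn : 0 ≤ ∑ j ∈ C.neg, (1 - boolPoint x j) := Finset.sum_nonneg fun j _ => h1 j
  constructor
  · intro h
    by_contra hne
    simp only [XClause.Sat, not_or, not_exists, not_and] at hne
    rw [Finset.sum_eq_zero fun j hj => by simp [boolPoint, hne.1 j hj],
      Finset.sum_eq_zero fun j hj => by simp [boolPoint, hne.2 j hj]] at h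
    norm_num at h
  · rintro (⟨j, hj, hx⟩ | ⟨j, hj, hx⟩)
    · have := Finset.single_le_sum (f := boolPoint x) (fun j _ => h0 j) hj
      simp only [boolPoint, hx, if_true] at this hp hn ⊢
      linarith
    · have := Finset.single_le_sum (f := fun j => 1 - boolPoint x j) (fun j _ => h1 j) hj
      simp only [boolPoint, hx] at this hp hn ⊢
      simp only [Bool.false_eq_true, if_false, sub_zero] at this
      linarith

open Classical in
/-- If every assignment satisfies at most `M` constraints, the integral optimum is at most `M`. -/
theorem integralOptimum_maxLP_le {n m : ℕ} {enc : Fin m → Set (XClause n)} {M : ℝ}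
    (hM : ∀ x : Fin n → Bool, (#{i | ∀ C ∈ enc i, C.Sat x} : ℝ) ≤ M) :
    (maxLP enc).integralOptimum ≤ M := by
  have hM0 : 0 ≤ M := (Nat.cast_nonneg _).trans (hM fun _ => true)
  refine Real.sSup_le ?_ hM0
  rintro _ ⟨z, ⟨hz, hint⟩, rfl⟩
  have hbool : ∀ v, z v = 0 ∨ z v = 1 := by
    intro v
    have h0 := (lowerIneq_holds_iff v z).1 (hz _ (.inr ⟨_, .inl rfl⟩))
    have h1 := (upperIneq_holds_iff v z).1 (hz _ (.inr ⟨_, .inr rfl⟩))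
    obtain ⟨t, ht⟩ := hint v
    rw [ht] at h0 h1 ⊢
    have h0 : 0 ≤ t := by exact_mod_cast h0
    have h1 : t ≤ 1 := by exact_mod_cast h1
    interval_cases t <;> simp
  let x : Fin n → Bool := fun j => decide (z (.inl j) = 1)
  have hx : ∀ j, z (.inl j) = boolPoint x j := by
    intro j
    rcases hbool (.inl j) with h | h <;> simp [boolPoint, x, h]
  refine le_trans ?_ (hM x)
  have hval : (maxLP enc).value z = ∑ i, z (.inr i) := by
    simp [LinProg.value, maxLP, Fintype.sum_sum_type]
  rw [hval, Finset.card_filter]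
  push_cast
  refine Finset.sum_le_sum fun i _ => ?_
  rcases hbool (.inr i) with h | h
  · rw [h]; split_ifs <;> norm_num
  · rw [if_pos, h]
    intro C hC
    have := (C.ineq_holds_iff i z).1 (hz _ (.inl ⟨i, C, hC, rfl⟩))
    rw [h] at this
    simp only [hx] at this
    exact (C.one_le_iff_sat x).1 this

/-- If some assignment satisfies some constraint, the integral optimum is positive. -/
theorem one_le_integralOptimum_maxLP {n m : ℕ} {enc : Fin m → Set (XClause n)} (i : Fin m)
    (x : Fin n → Bool) (hx : ∀ C ∈ enc i, C.Sat x) : 1 ≤ (maxLP enc).integralOptimum := by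
  classical
  have h0 : ∀ j, 0 ≤ boolPoint x j ∧ boolPoint x j ≤ 1 := fun j => by
    unfold boolPoint; split_ifs <;> norm_num
  refine le_csSup ⟨m, ?_⟩ ⟨Sum.elim (boolPoint x) fun i' => if i' = i then 1 else 0,
    ⟨fun I hI => ?_, ?_⟩, ?_⟩
  · rintro _ ⟨z, hz, rfl⟩
    exact LinProg.value_le_of_mem_feasible_maxLP hz.1
  · rcases hI with ⟨i', C, hC, rfl⟩ | ⟨v, rfl | rfl⟩
    · rw [XClause.ineq_holds_iff]
      by_cases h : i' = i
      · subst h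
        simpa using (C.one_le_iff_sat x).2 (hx C hC)
      · simp only [Sum.elim_inr, h, if_false, Sum.elim_inl]
        exact add_nonneg (Finset.sum_nonneg fun j _ => (h0 j).1)
          (Finset.sum_nonneg fun j _ => by linarith [(h0 j).2])
    · rw [lowerIneq_holds_iff]
      rcases v with v | v
      · exact (h0 v).1
      · simp only [Sum.elim_inr]; split_ifs <;> norm_num
    · rw [upperIneq_holds_iff]
      rcases v with v | v
      · exact (h0 v).2
      · simp only [Sum.elim_inr]; split_ifs <;> norm_num
  · rintro (v | v)
    · refine ⟨if x v then 1 else 0, ?_⟩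
      simp only [Sum.elim_inl, boolPoint]
      split_ifs <;> simp
    · refine ⟨if v = i then 1 else 0, ?_⟩
      simp only [Sum.elim_inr]
      split_ifs <;> simp
  · simp [LinProg.value, maxLP, Fintype.sum_sum_type]

open Classical in
/-- The integrality gap of a robust system of which only slightly more than a fraction `q` of the
constraints can be satisfied. -/
theorem inv_sub_le_scpGap_maxLP {n m k d : ℕ} {e : Fin m → KXor n k}
    {enc : Fin m → Set (XClause n)} (henc : ∀ i, enc i ⊆ (e i).clauses) (hd : 1 ≤ d)
    (hS : IsRobust (fun i => (e i).1.1) k (4 * d)) {q ε : ℝ} (hq : 1 / 2 ≤ q) (hε : 0 < ε)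
    (hm : 0 < m) (hsat : ∀ i, ∃ x, ∀ C ∈ enc i, C.Sat x)
    (hM : ∀ x : Fin n → Bool, (#{i | ∀ C ∈ enc i, C.Sat x} : ℝ) ≤ (q + ε / 4) * m) :
    q⁻¹ - ε ≤ (maxLP enc).scpGap d := by
  have h1 := le_optimum_scpRelaxation henc hd hS
  have h2 := integralOptimum_maxLP_le hM
  obtain ⟨x, hx⟩ := hsat ⟨0, hm⟩
  have h3 := one_le_integralOptimum_maxLP _ x hx
  have hm' : (0 : ℝ) < m := by exact_mod_cast hm
  have hq0 : 0 < q := by linarith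
  have h4 : (m : ℝ) / ((q + ε / 4) * m) ≤ (maxLP enc).scpGap d :=
    div_le_div₀ (hm'.le.trans h1) h1 (by linarith) h2
  refine le_trans ?_ h4
  rw [← div_div, div_right_comm, div_self hm'.ne', le_div_iff₀ (by positivity)]
  have h5 : q⁻¹ ≤ 2 := by
    rw [inv_le_comm₀ hq0 (by norm_num)]; linarith
  have h6 : q⁻¹ * q = 1 := inv_mul_cancel₀ hq0.ne'
  -- The product is `1 + ε / (4 * q) - ε * q - ε ^ 2 / 4`, and `q ≥ 1/2` makes the two linear terms
  -- in `ε` sum to at most `0`.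
  nlinarith [mul_nonneg hε.le hε.le, mul_le_mul_of_nonneg_left h5 hε.le]

/-! ### Probability estimates -/

section Uniform

variable {α : Type} [Fintype α] {m : ℕ}

theorem uniformProb_eq (P : (Fin m → α) → Prop) [DecidablePred P] :
    uniformProb m P = (#{F | P F} : ℝ) / (Fintype.card α : ℝ) ^ m := by
  rw [uniformProb, Nat.card_eq_fintype_card, Nat.card_eq_fintype_card, Fintype.card_subtype]
  simp

theorem uniformProb_le_sum {κ : Type} (s : Finset κ) {P : (Fin m → α) → Prop}
    {Q : κ → (Fin m → α) → Prop} (h : ∀ F, P F → ∃ i ∈ s, Q i F) :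
    uniformProb m P ≤ ∑ i ∈ s, uniformProb m (Q i) := by
  classical
  simp only [uniformProb_eq]
  rw [← Finset.sum_div]
  gcongr
  have : ({F | P F} : Finset (Fin m → α)) ⊆ s.biUnion fun i => {F | Q i F} := by
    intro F hF
    obtain ⟨i, hi, hQ⟩ := h F (by simpa using hF)
    exact Finset.mem_biUnion.2 ⟨i, hi, by simpa using hQ⟩
  exact_mod_cast (Finset.card_le_card this).trans Finset.card_biUnion_le

theorem uniformProb_le_one (P : (Fin m → α) → Prop) : uniformProb m P ≤ 1 := by
  classical
  rw [uniformProb_eq]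
  refine div_le_one_of_le₀ ?_ (by positivity)
  have := Finset.card_le_univ ({F | P F} : Finset (Fin m → α))
  simp only [Fintype.card_pi, Finset.prod_const, Finset.card_univ, Fintype.card_fin] at this
  exact_mod_cast this

theorem one_sub_le_uniformProb [Nonempty α] {P Q R : (Fin m → α) → Prop}
    (h : ∀ F, ¬ Q F → ¬ R F → P F) : 1 - uniformProb m Q - uniformProb m R ≤ uniformProb m P := by
  classical
  simp only [uniformProb_eq]
  have hpos : (0 : ℝ) < (Fintype.card α : ℝ) ^ m := by
    have : 0 < Fintype.card α := Fintype.card_pos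
    positivity
  rw [← div_self hpos.ne', ← sub_div, ← sub_div]
  gcongr
  have hsub : (Finset.univ : Finset (Fin m → α)) ⊆
      (({F | Q F} : Finset (Fin m → α)) ∪ ({F | R F} : Finset (Fin m → α))) ∪
        ({F | P F} : Finset (Fin m → α)) := by
    intro F _
    simp only [Finset.mem_union, Finset.mem_filter, Finset.mem_univ, true_and]
    by_contra! hc
    exact hc.2 (h F hc.1.1 hc.1.2)
  have h1 := (Finset.card_le_card hsub).trans ((Finset.card_union_le _ _).trans
    (Nat.add_le_add_right (Finset.card_union_le _ _) _))
  simp only [Finset.card_univ, Fintype.card_pi, Finset.prod_const, Fintype.card_fin] at h1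
  have h2 : (Fintype.card α : ℝ) ^ m ≤ (#{F | Q F} : ℝ) + #{F | R F} + #{F | P F} := by
    exact_mod_cast h1
  linarith

/-- Prescribing the coordinates in `T` to lie in a set of density at most `p`. -/
theorem uniformProb_forall_mem_le [Nonempty α] {G : α → Prop} [DecidablePred G] {p : ℝ}
    (hG : (#{a | G a} : ℝ) ≤ p * Fintype.card α) (T : Finset (Fin m)) :
    uniformProb m (fun F => ∀ i ∈ T, G (F i)) ≤ p ^ #T := by
  rw [uniformProb_eq]
  have hpos : (0 : ℝ) < Fintype.card α := by exact_mod_cast Fintype.card_pos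
  have hset : ({F | ∀ i ∈ T, G (F i)} : Finset (Fin m → α)) =
      Fintype.piFinset fun i => if i ∈ T then ({a | G a} : Finset α) else Finset.univ := by
    ext F
    simp only [Finset.mem_filter, Finset.mem_univ, true_and, Fintype.mem_piFinset]
    refine forall_congr' fun i => ?_
    split_ifs with h <;> simp [h]
  rw [hset, Fintype.card_piFinset, div_le_iff₀ (by positivity)]
  have h1 : ∀ i : Fin m, ((#(if i ∈ T then ({a | G a} : Finset α) else Finset.univ) : ℕ) : ℝ) ≤
      (if i ∈ T then p else 1) * Fintype.card α := by
    intro i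
    split_ifs
    · exact hG
    · simp
  push_cast
  refine (Finset.prod_le_prod (fun i _ => Nat.cast_nonneg _) fun i _ => h1 i).trans ?_
  rw [Finset.prod_mul_distrib, Finset.prod_const, Finset.card_univ, Fintype.card_fin]
  simp

/-- A Chernoff bound for the number of coordinates in a set of density at most `q`. -/
theorem uniformProb_lt_card_le [Nonempty α] {G : α → Prop} [DecidablePred G] {q δ : ℝ} (hq1 : q ≤ 1)
    (hδ : 0 < δ) (hδ2 : δ ≤ 2) (hG : (#{a | G a} : ℝ) ≤ q * Fintype.card α) :
    uniformProb m (fun F => (q + δ) * m < (#{i | G (F i)} : ℝ)) ≤ Real.exp (-(δ ^ 2 / 4)) ^ m := by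
  have hcard : (0 : ℝ) < Fintype.card α := by exact_mod_cast Fintype.card_pos
  -- This choice minimizes `t ^ 2 - t * δ`, the exponent per coordinate left after Markov's
  -- inequality for `exp (t * count)`; the minimum is `-δ ^ 2 / 4`.
  set t : ℝ := δ / 2 with ht
  have ht0 : 0 < t := by positivity
  have ht1 : |t| ≤ 1 := by rw [abs_of_pos ht0]; linarith
  have hexp : Real.exp t - 1 ≤ t + t ^ 2 := by
    have := (abs_le.1 (Real.abs_exp_sub_one_sub_id_le ht1)).2
    linarith
  have hexp0 : 0 ≤ Real.exp t - 1 := by linarith [Real.add_one_le_exp t]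
  let f : α → ℝ := fun a => if G a then Real.exp t else 1
  have hfsum : ∑ a, f a = Fintype.card α + (Real.exp t - 1) * #{a | G a} := by
    have : ∀ a, f a = 1 + (Real.exp t - 1) * (if G a then 1 else 0) := fun a => by
      simp only [f]; split_ifs <;> ring
    simp only [this, Finset.sum_add_distrib, ← Finset.mul_sum, Finset.card_filter]
    simp
  have hfle : ∑ a, f a ≤ Fintype.card α * Real.exp (q * t + t ^ 2) := by
    rw [hfsum]
    have h1 : (Real.exp t - 1) * #{a | G a} ≤ (Real.exp t - 1) * (q * Fintype.card α) :=
      mul_le_mul_of_nonneg_left hG hexp0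
    have hq0 : 0 ≤ q := by
      by_contra! h
      have : (0 : ℝ) ≤ #{a | G a} := Nat.cast_nonneg _
      nlinarith
    have h2 : q * (Real.exp t - 1) ≤ q * t + t ^ 2 := by
      nlinarith [mul_le_mul_of_nonneg_left hexp hq0, sq_nonneg t]
    have h3 := Real.add_one_le_exp (q * t + t ^ 2)
    nlinarith
  have hmoment : (#{F : Fin m → α | (q + δ) * m < (#{i | G (F i)} : ℝ)} : ℝ) *
      Real.exp (t * ((q + δ) * m)) ≤ (∑ a, f a) ^ m := by
    rw [Fintype.sum_pow, ← nsmul_eq_mul, ← Finset.sum_const]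
    refine (Finset.sum_le_sum fun F hF => ?_).trans
      (Finset.sum_le_sum_of_subset_of_nonneg (Finset.subset_univ _) fun F _ _ =>
        Finset.prod_nonneg fun i _ => by simp only [f]; split_ifs <;> positivity)
    have hF : (q + δ) * m < (#{i | G (F i)} : ℝ) := by simpa using hF
    have : ∏ i, f (F i) = Real.exp (t * #{i | G (F i)}) := by
      simp only [f]
      rw [Finset.prod_ite, Finset.prod_const, Finset.prod_const_one, mul_one, ← Real.exp_nat_mul,
        mul_comm]
    rw [this]
    exact Real.exp_le_exp.2 (mul_le_mul_of_nonneg_left hF.le ht0.le)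
  rw [uniformProb_eq, div_le_iff₀ (by positivity)]
  refine le_of_mul_le_mul_right (hmoment.trans ?_) (Real.exp_pos (t * ((q + δ) * m)))
  have hf0 : 0 ≤ ∑ a, f a := Finset.sum_nonneg fun a _ => by
    simp only [f]; split_ifs <;> positivity
  refine (pow_le_pow_left₀ hf0 hfle m).trans (le_of_eq ?_)
  rw [mul_pow, mul_right_comm, mul_comm, ← Real.exp_nat_mul, ← Real.exp_nat_mul, ← Real.exp_add]
  congr 2
  rw [ht]
  ring

end Uniform

/-! ### Random systems expand -/

theorem choose_mul_pow_self_le (m s : ℕ) :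
    (m.choose s : ℝ) * (s : ℝ) ^ s ≤ (Real.exp 1 * m) ^ s := by
  have h1 : (m.choose s : ℝ) ≤ (m : ℝ) ^ s / (s.factorial : ℝ) := Nat.choose_le_pow_div s m
  have h2 : (s : ℝ) ^ s / (s.factorial : ℝ) ≤ Real.exp s :=
    Real.pow_div_factorial_le_exp _ (Nat.cast_nonneg _) s
  calc (m.choose s : ℝ) * (s : ℝ) ^ s ≤ (m : ℝ) ^ s / (s.factorial : ℝ) * (s : ℝ) ^ s := by gcongr
    _ = (s : ℝ) ^ s / (s.factorial : ℝ) * (m : ℝ) ^ s := by ring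
    _ ≤ Real.exp s * (m : ℝ) ^ s := by gcongr
    _ = (Real.exp 1 * m) ^ s := by rw [mul_pow, ← Real.exp_nat_mul, mul_one]

/-- The union bound for sets of `s` constraints that cover at most `w` variables. -/
theorem choose_mul_choose_mul_pow_le {n k s w D : ℕ} {y : ℝ} (hn : 0 < n) (hk : 1 ≤ k)
    (hw0 : 0 < w) (hw : 4 * w + 5 * s ≤ 4 * (k * s)) (hy0 : 0 ≤ y) (hy1 : y ≤ 1)
    (hy : y ^ 4 = (s : ℝ) / n) :
    ((D * n).choose s : ℝ) * (n.choose w : ℝ) * (((w : ℝ) / n) ^ k) ^ s ≤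
      ((k : ℝ) ^ k * Real.exp (k + 1) * D * y) ^ s := by
  have hn' : (0 : ℝ) < n := by exact_mod_cast hn
  have hk' : (1 : ℝ) ≤ k := by exact_mod_cast hk
  -- Of the `k * s` factors `w / n`, `w` many cancel `n.choose w` up to `exp w`. The other `e ≥ 5 *
  -- s / 4` give `y ^ (5 * s)`, of which choosing the constraints uses up `y ^ (4 * s)`; a factor `y
  -- ^ s` survives.
  obtain ⟨e, he⟩ : ∃ e, k * s = w + e := Nat.exists_eq_add_of_le (by omega)
  have he5 : 5 * s ≤ 4 * e := by omega
  have h1 : (n.choose w : ℝ) * ((w : ℝ) / n) ^ w ≤ Real.exp w := by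
    have := choose_mul_pow_self_le n w
    rw [div_pow, ← mul_div_assoc, div_le_iff₀ (by positivity)]
    rwa [mul_pow, ← Real.exp_nat_mul, mul_one] at this
  have h2 : ((w : ℝ) / n) ^ e ≤ (k : ℝ) ^ (k * s) * y ^ (5 * s) := by
    have hwk : (w : ℝ) / n ≤ k * y ^ 4 := by
      rw [hy, ← mul_div_assoc]
      gcongr
      exact_mod_cast (by omega : w ≤ k * s)
    calc ((w : ℝ) / n) ^ e ≤ (k * y ^ 4) ^ e := by gcongr
      _ = (k : ℝ) ^ e * y ^ (4 * e) := by rw [mul_pow, ← pow_mul]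
      _ ≤ (k : ℝ) ^ (k * s) * y ^ (5 * s) := by
        gcongr ?_ * ?_
        · exact pow_le_pow_right₀ hk' (by omega)
        · exact pow_le_pow_of_le_one hy0 hy1 he5
  have h3 : ((D * n).choose s : ℝ) * y ^ (4 * s) ≤ (Real.exp 1 * D) ^ s := by
    have := choose_mul_pow_self_le (D * n) s
    rw [pow_mul, hy, div_pow, ← mul_div_assoc, div_le_iff₀ (by positivity), ← mul_pow]
    push_cast at this
    rwa [mul_assoc]
  have h4 : Real.exp w ≤ Real.exp k ^ s := by
    rw [← Real.exp_nat_mul]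
    refine Real.exp_le_exp.2 ?_
    have : w ≤ s * k := by rw [mul_comm]; omega
    exact_mod_cast this
  calc ((D * n).choose s : ℝ) * (n.choose w : ℝ) * (((w : ℝ) / n) ^ k) ^ s
      = ((D * n).choose s : ℝ) * (((n.choose w : ℝ) * ((w : ℝ) / n) ^ w) * ((w : ℝ) / n) ^ e) := by
        rw [← pow_mul, he, pow_add]; ring
    _ ≤ ((D * n).choose s : ℝ) * (Real.exp k ^ s * ((k : ℝ) ^ (k * s) * y ^ (5 * s))) := by
        gcongr
        exact h1.trans h4
    _ = Real.exp k ^ s * (k : ℝ) ^ (k * s) * y ^ s * (((D * n).choose s : ℝ) * y ^ (4 * s)) := by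
        rw [show 5 * s = s + 4 * s by ring, pow_add]; ring
    _ ≤ Real.exp k ^ s * (k : ℝ) ^ (k * s) * y ^ s * (Real.exp 1 * D) ^ s := by gcongr
    _ = ((k : ℝ) ^ k * Real.exp (k + 1) * D * y) ^ s := by
        rw [Real.exp_add, pow_mul, ← mul_pow, ← mul_pow, ← mul_pow]
        congr 1
        ring

/-- The probability that some `s` constraints cover too few variables. -/
theorem uniformProb_not_expanding_card_le {α : Type} [Fintype α] [Nonempty α] {n m k s : ℕ}
    (v : α → Finset (Fin n)) (hn : 0 < n) (hs : k * s ≤ n)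
    (hv : ∀ W : Finset (Fin n), #{a | v a ⊆ W} * n ^ k ≤ #W ^ k * Fintype.card α) :
    uniformProb m (fun F => ∃ T : Finset (Fin m), #T = s ∧
        4 * #(T.biUnion fun i => v (F i)) < (4 * k - 5) * #T) ≤
      (m.choose s : ℝ) * (n.choose ((4 * k - 5) * s / 4) : ℝ) *
        ((((((4 * k - 5) * s / 4 : ℕ) : ℝ)) / n) ^ k) ^ s := by
  set w := (4 * k - 5) * s / 4 with hw
  have hn' : (0 : ℝ) < n := by exact_mod_cast hn
  have hwn : w ≤ n := by
    have : (4 * k - 5) * s ≤ 4 * k * s := Nat.mul_le_mul_right s (Nat.sub_le _ _)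
    rw [mul_assoc] at this
    omega
  refine (uniformProb_le_sum (κ := Finset (Fin m) × Finset (Fin n))
    (powersetCard s univ ×ˢ powersetCard w univ)
    (Q := fun TW F => ∀ i ∈ TW.1, v (F i) ⊆ TW.2) ?_).trans ?_
  · rintro F ⟨T, hT, hlt⟩
    -- The union is padded to exactly `w` elements, so that the union bound runs over sets `W` of
    -- one size.
    obtain ⟨W, hW1, hW2⟩ := Finset.exists_superset_card_eq (s := T.biUnion fun i => v (F i))
      (n := w) (by rw [hT] at hlt; omega) (by simpa using hwn)
    refine ⟨(T, W), by simp [hT, hW2], fun i hi => ?_⟩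
    exact (Finset.subset_biUnion_of_mem (fun i => v (F i)) hi).trans hW1
  · refine (Finset.sum_le_card_nsmul _ _ ((((w : ℝ) / n) ^ k) ^ s) ?_).trans (le_of_eq ?_)
    · rintro ⟨T, W⟩ hTW
      simp only [Finset.mem_product, Finset.mem_powersetCard, Finset.subset_univ, true_and] at hTW
      rw [← hTW.1]
      refine uniformProb_forall_mem_le (G := fun a => v a ⊆ W) ?_ T
      rw [div_pow, div_mul_eq_mul_div, le_div_iff₀ (by positivity), ← hTW.2]
      exact_mod_cast hv W
    · simp [Finset.card_product]

/-- With high probability, random systems of linearly many constraints expand up to linear size. -/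
theorem uniformProb_not_isExpanding_le {α : Type} [Fintype α] [Nonempty α] {n k D r : ℕ} {η B : ℝ}
    (v : α → Finset (Fin n)) (hn : 0 < n) (hk : 6 ≤ k) (hD : 1 ≤ D)
    (hv : ∀ W : Finset (Fin n), Nat.card {a // v a ⊆ W} * n ^ k ≤ #W ^ k * Fintype.card α)
    (hB : B = (k : ℝ) ^ k * Real.exp (k + 1) * D) (hr : (r : ℝ) ≤ (2 * B)⁻¹ ^ 4 * n)
    (hη0 : 0 ≤ η) (hη : η ^ 4 = (n : ℝ)⁻¹) :
    uniformProb (D * n) (fun F : Fin (D * n) → α => ¬ IsExpanding (fun i => v (F i)) k r) ≤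
      B * η * ∑' s : ℕ, (s : ℝ) * 2⁻¹ ^ (s - 1) := by
  classical
  have hn' : (0 : ℝ) < n := by exact_mod_cast hn
  have hk' : (6 : ℝ) ≤ k := by exact_mod_cast hk
  have hBk : (k : ℝ) ≤ B := by
    rw [hB]
    have h1 : (k : ℝ) ≤ (k : ℝ) ^ k := le_self_pow₀ (by linarith) (by omega)
    have h2 : (1 : ℝ) ≤ Real.exp (k + 1) := Real.one_le_exp (by positivity)
    have h3 : (1 : ℝ) ≤ D := by exact_mod_cast hD
    calc (k : ℝ) ≤ (k : ℝ) ^ k * 1 * 1 := by simpa using h1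
      _ ≤ _ := by gcongr
  have hB0 : 0 < B := by linarith
  have hsummable : Summable fun s : ℕ => (s : ℝ) * (2⁻¹ : ℝ) ^ (s - 1) := by
    have h := summable_pow_mul_geometric_of_norm_lt_one 1 (r := (2⁻¹ : ℝ)) (by norm_num)
    refine (h.mul_left 2).congr fun s => ?_
    rcases s with _ | s
    · simp
    · simp only [Nat.add_sub_cancel, pow_succ]; ring
  have hterm : ∀ s ∈ Finset.Icc 1 r, uniformProb (D * n) (fun F : Fin (D * n) → α =>
      ∃ T : Finset (Fin (D * n)), #T = s ∧
        4 * #(T.biUnion fun i => v (F i)) < (4 * k - 5) * #T) ≤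
      B * η * ((s : ℝ) * 2⁻¹ ^ (s - 1)) := by
    intro s hs
    obtain ⟨hs1, hsr⟩ := Finset.mem_Icc.1 hs
    have hs1' : (1 : ℝ) ≤ s := by exact_mod_cast hs1
    let y : ℝ := ((s : ℝ) / n) ^ (4⁻¹ : ℝ)
    have hy0 : 0 ≤ y := by positivity
    have hy : y ^ 4 = (s : ℝ) / n := by
      simp only [y]
      rw [← Real.rpow_natCast, ← Real.rpow_mul (by positivity)]
      norm_num
    have hyB : y ≤ (2 * B)⁻¹ := by
      refine le_of_pow_le_pow_left₀ (n := 4) (by norm_num) (by positivity) ?_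
      rw [hy, div_le_iff₀ hn']
      exact le_trans (by exact_mod_cast hsr) hr
    have hy1 : y ≤ 1 := hyB.trans (inv_le_one_of_one_le₀ (by linarith))
    -- In `(B * y) ^ s` one factor is bounded by `B * s * η`, which tends to `0` with `n`, and the
    -- others by `1/2`, which makes the sum over `s` converge.
    have hyη : y ≤ s * η := by
      refine le_of_pow_le_pow_left₀ (n := 4) (by norm_num) (by positivity) ?_
      rw [hy, mul_pow, hη, div_eq_mul_inv]
      gcongr
      exact le_self_pow₀ hs1' (by norm_num)
    have hksn : k * s ≤ n := by
      have h1 : (s : ℝ) ≤ (2 * B)⁻¹ ^ 4 * n := le_trans (by exact_mod_cast hsr) hr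
      have h2 : (2 * B)⁻¹ ^ 4 ≤ B⁻¹ := by
        calc (2 * B)⁻¹ ^ 4 ≤ (2 * B)⁻¹ :=
              pow_le_of_le_one (by positivity) (inv_le_one_of_one_le₀ (by linarith)) (by norm_num)
          _ ≤ B⁻¹ := by gcongr; linarith
      have h3 : (s : ℝ) ≤ B⁻¹ * n := h1.trans (by gcongr)
      have h4 : (k : ℝ) * s ≤ n := by
        calc (k : ℝ) * s ≤ B * (B⁻¹ * n) := by gcongr
          _ = n := by rw [mul_inv_cancel_left₀ hB0.ne']
      exact_mod_cast h4
    have hwle : 4 * ((4 * k - 5) * s / 4) + 5 * s ≤ 4 * (k * s) := by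
      have h1 : (4 * k - 5) * s + 5 * s = 4 * (k * s) := by
        rw [← add_mul, Nat.sub_add_cancel (by omega), mul_assoc]
      omega
    have hw0 : 0 < (4 * k - 5) * s / 4 := by
      have : 19 * 1 ≤ (4 * k - 5) * s := Nat.mul_le_mul (by omega) hs1
      omega
    refine (uniformProb_not_expanding_card_le v hn hksn fun W => ?_).trans
      ((choose_mul_choose_mul_pow_le hn (by omega) hw0 hwle hy0 hy1 hy).trans ?_)
    · have := hv W
      rwa [Nat.card_eq_fintype_card, Fintype.card_subtype] at this
    · rw [← hB]
      obtain ⟨t, rfl⟩ := Nat.exists_eq_add_of_le hs1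
      have hBy : B * y ≤ 2⁻¹ := by
        calc B * y ≤ B * (2 * B)⁻¹ := by gcongr
          _ = 2⁻¹ := by field_simp
      rw [Nat.add_sub_cancel_left, pow_add, pow_one]
      calc B * y * (B * y) ^ t ≤ B * (((1 + t : ℕ) : ℝ) * η) * 2⁻¹ ^ t := by gcongr
        _ = _ := by ring
  refine (uniformProb_le_sum (Finset.Icc 1 r) fun F hF => ?_).trans
    ((Finset.sum_le_sum hterm).trans ?_)
  · simp only [IsExpanding, not_forall, not_le] at hF
    obtain ⟨T, hT, hlt⟩ := hF
    refine ⟨#T, Finset.mem_Icc.2 ⟨?_, hT⟩, T, rfl, hlt⟩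
    by_contra! h
    have : #T = 0 := by omega
    rw [this] at hlt
    omega
  · rw [← Finset.mul_sum]
    refine mul_le_mul_of_nonneg_left ?_ (by positivity)
    exact hsummable.sum_le_tsum _ fun s _ => by positivity

/-- Random systems of linearly many constraints, each satisfied with probability at most `q` by any
given assignment, are with high probability expanding and at most about `q`-satisfiable, so any
quantity bounded below on such systems is bounded below with high probability. -/
theorem exists_tendsto_uniformProb_one {k : ℕ} (hk : 6 ≤ k) {q δ c : ℝ} (hq1 : q ≤ 1)
    (hδ : 0 < δ) (α : ℕ → Type) [∀ n, Fintype (α n)] (hne : ∀ n, k ≤ n → Nonempty (α n))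
    (v : ∀ n, α n → Finset (Fin n)) (sat : ∀ n, α n → (Fin n → Bool) → Prop)
    (hv : ∀ n (W : Finset (Fin n)),
      Nat.card {a // v n a ⊆ W} * n ^ k ≤ #W ^ k * Fintype.card (α n))
    (hsat : ∀ n x, (Nat.card {a // sat n a x} : ℝ) ≤ q * Fintype.card (α n))
    (gap : ∀ n m, (Fin m → α n) → ℕ → ℝ)
    (hgap : ∀ n m (F : Fin m → α n) d, 1 ≤ d → 0 < m →
      IsExpanding (fun i => v n (F i)) k (8 * d) →
      (∀ x, (Nat.card {i // sat n (F i) x} : ℝ) ≤ (q + δ) * m) → c ≤ gap n m F d) :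
    ∃ κ : ℝ, 0 < κ ∧ ∃ m : ℕ → ℕ,
      ((fun n => (m n : ℝ)) =O[Filter.atTop] fun n : ℕ => (n : ℝ)) ∧
      Filter.Tendsto (fun n : ℕ => uniformProb (m n) fun F : Fin (m n) → α n =>
        c ≤ gap n (m n) F ⌊κ * n⌋₊) Filter.atTop (nhds 1) := by
  classical
  -- The Chernoff bound needs a bounded deviation; shrinking `δ` only strengthens the bound on
  -- satisfied constraints.
  set δ' := min δ 1 with hδ'
  have hδ0 : 0 < δ' := lt_min hδ one_pos
  have hδ1 : δ' ≤ 1 := min_le_right _ _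
  -- With this density the failure probability is at most `exp (-n)` per assignment, which beats the
  -- `2 ^ n` assignments because `2 < e`.
  obtain ⟨D, hD⟩ := exists_nat_ge (4 / δ' ^ 2)
  have hD4 : 4 ≤ D * δ' ^ 2 := by rwa [div_le_iff₀ (by positivity)] at hD
  have hD1 : 1 ≤ D := by
    by_contra! h
    have : D = 0 := by omega
    rw [this] at hD4
    norm_num at hD4
  set B : ℝ := (k : ℝ) ^ k * Real.exp (k + 1) * D with hB
  have hB0 : 0 < B := by
    have : 0 < k := by omega
    positivity
  -- Depth `d` requires expansion up to `8 * d`, and the first-moment bound provides it up to `(2 *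
  -- B)⁻¹ ^ 4 * n`.
  set κ : ℝ := (2 * B)⁻¹ ^ 4 / 8 with hκ
  have hκ0 : 0 < κ := by positivity
  refine ⟨κ, hκ0, fun n => D * n, ?_, ?_⟩
  · refine Asymptotics.IsBigO.of_bound D (Filter.Eventually.of_forall fun n => ?_)
    simp
  set σ : ℝ := ∑' s : ℕ, (s : ℝ) * 2⁻¹ ^ (s - 1)
  have hlim : Filter.Tendsto (fun n : ℕ => 1 - (2 * Real.exp (-1)) ^ n -
      B * ((n : ℝ) ^ (-(4⁻¹ : ℝ))) * σ) Filter.atTop (nhds 1) := by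
    have h1 : Filter.Tendsto (fun n : ℕ => (2 * Real.exp (-1)) ^ n) Filter.atTop (nhds 0) := by
      refine tendsto_pow_atTop_nhds_zero_of_lt_one (by positivity) ?_
      rw [Real.exp_neg, ← div_eq_mul_inv, div_lt_one (Real.exp_pos 1)]
      linarith [Real.exp_one_gt_d9]
    have h2 : Filter.Tendsto (fun n : ℕ => (n : ℝ) ^ (-(4⁻¹ : ℝ))) Filter.atTop (nhds 0) :=
      (tendsto_rpow_neg_atTop (by norm_num)).comp tendsto_natCast_atTop_atTop
    simpa using (tendsto_const_nhds.sub h1).sub ((h2.const_mul B).mul_const σ)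
  refine tendsto_of_tendsto_of_tendsto_of_le_of_le' hlim tendsto_const_nhds ?_
    (Filter.Eventually.of_forall fun n => uniformProb_le_one _)
  have hlarge : ∀ᶠ n : ℕ in Filter.atTop, 1 ≤ κ * n :=
    (tendsto_natCast_atTop_atTop.const_mul_atTop hκ0).eventually_ge_atTop 1
  filter_upwards [hlarge, Filter.eventually_ge_atTop k] with n hκn hkn
  have := hne n hkn
  have hn : 0 < n := by omega
  have hn' : (0 : ℝ) < n := by exact_mod_cast hn
  have hd : 1 ≤ ⌊κ * n⌋₊ := Nat.le_floor (by simpa using hκn)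
  have hexp := uniformProb_not_isExpanding_le (α := α n) (r := 8 * ⌊κ * n⌋₊)
    (η := (n : ℝ) ^ (-(4⁻¹ : ℝ))) (v n) hn hk hD1 (hv n) hB
    (by
      have := Nat.floor_le (mul_nonneg hκ0.le hn'.le)
      push_cast
      rw [hκ] at this ⊢
      linarith) (by positivity)
    (by
      rw [← Real.rpow_natCast, ← Real.rpow_mul hn'.le]
      norm_num
      rw [Real.rpow_neg_one])
  have hchern : uniformProb (D * n) (fun F : Fin (D * n) → α n => ∃ x : Fin n → Bool,
      (q + δ') * (D * n : ℕ) < (#{i | sat n (F i) x} : ℝ)) ≤ (2 * Real.exp (-1)) ^ n := by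
    refine (uniformProb_le_sum (Finset.univ : Finset (Fin n → Bool))
      (Q := fun x F => (q + δ') * (D * n : ℕ) < (#{i | sat n (F i) x} : ℝ))
      fun F ⟨x, hx⟩ => ⟨x, Finset.mem_univ _, hx⟩).trans ?_
    have hx : ∀ x ∈ (Finset.univ : Finset (Fin n → Bool)),
        uniformProb (D * n) (fun F : Fin (D * n) → α n =>
          (q + δ') * (D * n : ℕ) < (#{i | sat n (F i) x} : ℝ)) ≤ Real.exp (-1) ^ n := by
      intro x _
      refine (uniformProb_lt_card_le (G := fun a => sat n a x) hq1 hδ0 (by linarith) ?_).trans ?_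
      · have := hsat n x
        rwa [Nat.card_eq_fintype_card, Fintype.card_subtype] at this
      · rw [pow_mul]
        gcongr
        rw [← Real.exp_nat_mul]
        exact Real.exp_le_exp.2 (by linarith)
    refine (Finset.sum_le_card_nsmul _ _ _ hx).trans (le_of_eq ?_)
    simp [mul_pow]
  refine le_trans ?_ (one_sub_le_uniformProb
    (Q := fun F => ∃ x : Fin n → Bool, (q + δ') * (D * n : ℕ) < (#{i | sat n (F i) x} : ℝ))
    (R := fun F => ¬ IsExpanding (fun i => v n (F i)) k (8 * ⌊κ * n⌋₊)) fun F hF1 hF2 => ?_)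
  · exact sub_le_sub (sub_le_sub_left hchern 1) hexp
  · refine hgap n (D * n) F _ hd (Nat.mul_pos hD1 hn) (not_not.1 hF2) fun x => ?_
    rw [Nat.card_eq_fintype_card, Fintype.card_subtype]
    push Not at hF1
    refine (hF1 x).trans ?_
    gcongr
    exact min_le_left _ _

/-! ### Random equations and clauses -/

/-- Factor by factor, `(w - i) / (n - i) ≤ w / n`: choosing without repetition makes it no likelier
to stay inside a given set of `w` variables. -/
theorem choose_mul_pow_le_pow_mul_choose {w n : ℕ} (h : w ≤ n) (k : ℕ) :
    w.choose k * n ^ k ≤ w ^ k * n.choose k := by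
  have hdesc : w.descFactorial k * n ^ k ≤ w ^ k * n.descFactorial k := by
    induction k with
    | zero => simp
    | succ k ih =>
      have h1 : (w - k) * n ≤ w * (n - k) := by
        rw [Nat.sub_mul, Nat.mul_sub]
        have := Nat.mul_le_mul_left k h
        have := mul_comm w k
        omega
      rw [Nat.descFactorial_succ, Nat.descFactorial_succ, pow_succ, pow_succ]
      calc (w - k) * w.descFactorial k * (n ^ k * n)
          = (w.descFactorial k * n ^ k) * ((w - k) * n) := by ring
        _ ≤ (w ^ k * n.descFactorial k) * (w * (n - k)) := Nat.mul_le_mul ih h1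
        _ = w ^ k * w * ((n - k) * n.descFactorial k) := by ring
  rw [Nat.descFactorial_eq_factorial_mul_choose, Nat.descFactorial_eq_factorial_mul_choose] at hdesc
  refine Nat.le_of_mul_le_mul_left ?_ k.factorial_pos
  calc _ = k.factorial * w.choose k * n ^ k := by ring
    _ ≤ _ := hdesc
    _ = _ := by ring

theorem card_kXor (n k : ℕ) : Fintype.card (KXor n k) = n.choose k * 2 := by
  rw [Fintype.card_prod, Fintype.card_finset_len, ZMod.card, Fintype.card_fin]

theorem card_kXor_subset_le {n k : ℕ} (W : Finset (Fin n)) :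
    Nat.card {e : KXor n k // e.1.1 ⊆ W} * n ^ k ≤ #W ^ k * Fintype.card (KXor n k) := by
  have h : Nat.card {e : KXor n k // e.1.1 ⊆ W} ≤ (#W).choose k * 2 := by
    have := Nat.card_le_card_of_injective
      (β := {S // S ∈ powersetCard k W} × ZMod 2)
      (fun e : {e : KXor n k // e.1.1 ⊆ W} =>
        (⟨e.1.1.1, Finset.mem_powersetCard.2 ⟨e.2, e.1.1.2⟩⟩, e.1.2))
      (by
        rintro ⟨⟨⟨S, hS⟩, b⟩, hW⟩ ⟨⟨⟨S', hS'⟩, b'⟩, hW'⟩ heq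
        simp only [Prod.mk.injEq, Subtype.mk.injEq] at heq ⊢
        exact heq)
    rwa [Nat.card_prod, Nat.card_eq_fintype_card (α := {S // S ∈ powersetCard k W}),
      Fintype.card_coe, Finset.card_powersetCard, Nat.card_zmod] at this
  rw [card_kXor]
  have hW : #W ≤ n := by simpa using Finset.card_le_univ W
  calc _ ≤ (#W).choose k * 2 * n ^ k := Nat.mul_le_mul_right _ h
    _ = (#W).choose k * n ^ k * 2 := by ring
    _ ≤ #W ^ k * n.choose k * 2 := Nat.mul_le_mul_right _ (choose_mul_pow_le_pow_mul_choose hW k)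
    _ = _ := by ring

theorem XClause.sat_sdiff_iff {n : ℕ} {S N : Finset (Fin n)} (hN : N ⊆ S) (x : Fin n → Bool) :
    (⟨S \ N, N⟩ : XClause n).Sat x ↔ ({j ∈ S | x j = true} : Finset (Fin n)) ≠ N := by
  rw [← not_iff_not, not_not]
  simp only [XClause.Sat, not_or, not_exists, not_and, Finset.ext_iff, Finset.mem_filter,
    Finset.mem_sdiff, Bool.not_eq_true, Bool.not_eq_false]
  constructor
  · rintro ⟨h1, h2⟩ j
    refine ⟨fun ⟨hj, hx⟩ => ?_, fun hj => ⟨hN hj, h2 j hj⟩⟩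
    by_contra hjN
    simp [h1 j ⟨hj, hjN⟩] at hx
  · intro h
    refine ⟨fun j hj => ?_, fun j hj => ((h j).2 hj).2⟩
    by_contra hx
    exact hj.2 ((h j).1 ⟨hj.1, by simpa using hx⟩)

theorem KXor.forall_sat_iff {n k : ℕ} (e : KXor n k) (x : Fin n → Bool) :
    (∀ C ∈ e.clauses, C.Sat x) ↔ (#{j ∈ e.1.1 | x j = true} : ZMod 2) = e.2 := by
  constructor
  · intro h
    by_contra hne
    exact (XClause.sat_sdiff_iff (Finset.filter_subset _ _) x).1
      (h _ ⟨_, Finset.filter_subset _ _, hne, rfl⟩) rfl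
  · rintro h _ ⟨N, hN, hNb, rfl⟩
    rw [XClause.sat_sdiff_iff hN]
    rintro rfl
    exact hNb h

/-- For a fixed assignment, the variable set determines the only right-hand side that is satisfied.
-/
theorem card_kXor_sat_le {n k : ℕ} (x : Fin n → Bool) :
    (Nat.card {e : KXor n k // ∀ C ∈ e.clauses, C.Sat x} : ℝ) ≤
      1 / 2 * Fintype.card (KXor n k) := by
  have h : Nat.card {e : KXor n k // ∀ C ∈ e.clauses, C.Sat x} ≤ n.choose k := by
    have := Nat.card_le_card_of_injective (β := {S : Finset (Fin n) // #S = k})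
      (fun e : {e : KXor n k // ∀ C ∈ e.clauses, C.Sat x} => e.1.1)
      (by
        rintro ⟨⟨S, b⟩, h⟩ ⟨⟨S', b'⟩, h'⟩ heq
        rw [KXor.forall_sat_iff] at h h'
        simp only at heq h h'
        subst heq
        exact Subtype.ext (Prod.ext rfl (h.symm.trans h')))
    simpa [Nat.card_eq_fintype_card] using this
  rw [card_kXor]
  push_cast
  have : (Nat.card {e : KXor n k // ∀ C ∈ e.clauses, C.Sat x} : ℝ) ≤ n.choose k := by
    exact_mod_cast h
  linarith

theorem KXor.exists_forall_sat {n k : ℕ} (hk : 0 < k) (e : KXor n k) :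
    ∃ x : Fin n → Bool, ∀ C ∈ e.clauses, C.Sat x := by
  obtain ⟨j, hj⟩ := Finset.card_pos.1 (e.1.2.symm ▸ hk : 0 < #e.1.1)
  have hbit : ∀ b : ZMod 2, b = 0 ∨ b = 1 := by decide
  rcases hbit e.2 with h | h
  · exact ⟨fun _ => false, (e.forall_sat_iff _).2 (by simp [h])⟩
  · refine ⟨fun i => decide (i = j), (e.forall_sat_iff _).2 ?_⟩
    have : ({i ∈ e.1.1 | decide (i = j) = true} : Finset (Fin n)) = {j} := by
      ext i
      simp only [decide_eq_true_eq, Finset.mem_filter, Finset.mem_singleton]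
      exact ⟨fun h => h.2, fun h => ⟨h ▸ hj, h⟩⟩
    rw [this, h]
    simp

/-- A clause is encoded by its variable set together with the subset of negated variables. -/
theorem card_kClause_subset {n k : ℕ} (W : Finset (Fin n)) :
    #{C : KClause n k | C.1.1 ∪ C.1.2 ⊆ W} = (#W).choose k * 2 ^ k := by
  have h : #((powersetCard k W).sigma fun S => S.powerset) = (#W).choose k * 2 ^ k := by
    rw [Finset.card_sigma, Finset.sum_congr rfl fun S hS => by
      rw [Finset.card_powerset, (Finset.mem_powersetCard.1 hS).2]]
    simp
  rw [← h]
  refine Finset.card_bij (fun C _ => ⟨C.1.1 ∪ C.1.2, C.1.2⟩) ?_ ?_ ?_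
  · intro C hC
    simp only [Finset.mem_filter, Finset.mem_univ, true_and] at hC
    simp only [Finset.mem_sigma, Finset.mem_powersetCard, Finset.mem_powerset]
    exact ⟨⟨hC, (Finset.card_union_of_disjoint C.2.1).trans C.2.2⟩, Finset.subset_union_right⟩
  · rintro ⟨⟨P, N⟩, hd, hc⟩ _ ⟨⟨P', N'⟩, hd', hc'⟩ _ heq
    simp only [Sigma.mk.injEq, heq_eq_eq] at heq
    obtain ⟨h1, rfl⟩ := heq
    have hd : Disjoint P N := hd
    have hd' : Disjoint P' N := hd'
    have : P = P' := by
      rw [← Finset.union_sdiff_cancel_right hd, ← Finset.union_sdiff_cancel_right hd', h1]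
    subst this
    rfl
  · rintro ⟨S, N⟩ hSN
    simp only [Finset.mem_sigma, Finset.mem_powersetCard, Finset.mem_powerset] at hSN
    obtain ⟨⟨hSW, hSk⟩, hNS⟩ := hSN
    have hun : S \ N ∪ N = S := Finset.sdiff_union_of_subset hNS
    refine ⟨⟨(S \ N, N), Finset.sdiff_disjoint, ?_⟩, ?_, ?_⟩
    · rw [← Finset.card_union_of_disjoint Finset.sdiff_disjoint, hun, hSk]
    · simpa [hun] using hSW
    · simp [hun]

theorem card_kClause (n k : ℕ) : Fintype.card (KClause n k) = n.choose k * 2 ^ k := by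
  have := card_kClause_subset (n := n) (k := k) Finset.univ
  rw [Finset.filter_true_of_mem fun C _ => Finset.subset_univ _] at this
  simpa using this

theorem card_kClause_subset_le {n k : ℕ} (W : Finset (Fin n)) :
    Nat.card {C : KClause n k // C.1.1 ∪ C.1.2 ⊆ W} * n ^ k ≤
      #W ^ k * Fintype.card (KClause n k) := by
  rw [Nat.card_eq_fintype_card, Fintype.card_subtype, card_kClause_subset, card_kClause]
  have hW : #W ≤ n := by simpa using Finset.card_le_univ W
  calc _ = (#W).choose k * n ^ k * 2 ^ k := by ring
    _ ≤ #W ^ k * n.choose k * 2 ^ k :=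
        Nat.mul_le_mul_right _ (choose_mul_pow_le_pow_mul_choose hW k)
    _ = _ := by ring

/-- The underlying clause of a `KClause`. -/
def KClause.clause {n k : ℕ} (C : KClause n k) : XClause n := ⟨C.1.1, C.1.2⟩

theorem card_kClause_sat_le {n k : ℕ} (x : Fin n → Bool) :
    (Nat.card {C : KClause n k // (KClause.clause C).Sat x} : ℝ) ≤
      (1 - ((2 : ℝ) ^ k)⁻¹) * Fintype.card (KClause n k) := by
  classical
  have hunsat : n.choose k ≤ #{C : KClause n k | ¬ (KClause.clause C).Sat x} := by
    have : #(powersetCard k (Finset.univ : Finset (Fin n))) = n.choose k := by simp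
    rw [← this]
    -- Every `k`-set carries a clause falsified by `x`: the one negating exactly the variables that
    -- are true.
    refine Finset.card_le_card_of_surjOn (fun C : KClause n k => C.1.1 ∪ C.1.2) ?_
    intro S hS
    have hS : #S = k := by simpa using hS
    have hdisj : Disjoint ({j ∈ S | ¬ x j = true} : Finset (Fin n))
        ({j ∈ S | x j = true} : Finset (Fin n)) := (Finset.disjoint_filter_filter_not _ _ _).symm
    have hun : ({j ∈ S | ¬ x j = true} : Finset (Fin n)) ∪
        ({j ∈ S | x j = true} : Finset (Fin n)) = S := by
      rw [Finset.union_comm, Finset.filter_union_filter_not_eq]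
    refine ⟨⟨(_, _), hdisj, (Finset.card_union_of_disjoint hdisj).symm.trans (by rw [hun, hS])⟩, ?_, hun⟩
    simp [KClause.clause, XClause.Sat]
  have hsplit : #{C : KClause n k | (KClause.clause C).Sat x} +
      #{C : KClause n k | ¬ (KClause.clause C).Sat x} = n.choose k * 2 ^ k := by
    rw [Finset.card_filter_add_card_filter_not, Finset.card_univ, card_kClause]
  rw [Nat.card_eq_fintype_card, Fintype.card_subtype, card_kClause]
  have h1 : (n.choose k : ℝ) ≤ #{C : KClause n k | ¬ (KClause.clause C).Sat x} := by
    exact_mod_cast hunsat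
  have h2 : (#{C : KClause n k | (KClause.clause C).Sat x} : ℝ) +
      #{C : KClause n k | ¬ (KClause.clause C).Sat x} = n.choose k * 2 ^ k := by
    exact_mod_cast hsplit
  have h3 : (1 - ((2 : ℝ) ^ k)⁻¹) * (n.choose k * 2 ^ k) = n.choose k * 2 ^ k - n.choose k := by
    field_simp
  push_cast
  rw [h3]
  linarith

theorem KClause.exists_sat {n k : ℕ} (hk : 0 < k) (C : KClause n k) :
    ∃ x : Fin n → Bool, (KClause.clause C).Sat x := by
  refine ⟨fun j => decide (j ∈ C.1.1), ?_⟩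
  obtain ⟨j, hj⟩ : (C.1.1 ∪ C.1.2).Nonempty := Finset.card_pos.1 (by
    rw [Finset.card_union_of_disjoint C.2.1, C.2.2]; exact hk)
  rcases Finset.mem_union.1 hj with h | h
  · exact .inl ⟨j, h, by simpa using h⟩
  · exact .inr ⟨j, h, by simpa using Finset.disjoint_right.1 C.2.1 h⟩

/-- An equation mod 2 on the variables of a clause that implies the clause. -/
def KClause.xor {n k : ℕ} (C : KClause n k) : KXor n k :=
  (⟨C.1.1 ∪ C.1.2, (Finset.card_union_of_disjoint C.2.1).trans C.2.2⟩, #C.1.2 + 1)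

/-- The assignment falsifying the clause is `1` exactly on the negated variables, and the equation
demands the opposite parity. -/
theorem KClause.clause_mem_xor {n k : ℕ} (C : KClause n k) :
    KClause.clause C ∈ (KClause.xor C).clauses := by
  refine ⟨C.1.2, Finset.subset_union_right, ?_, ?_⟩
  · simp [KClause.xor]
  · simp only [KClause.clause, KClause.xor]
    rw [Finset.union_sdiff_cancel_right C.2.1]

/-! ### Assembling the gaps for equations and for clauses -/

theorem mainTheorem11 (ε : ℝ) (hε : 0 < ε) (k : ℕ) (hk : 6 ≤ k) :
    (∃ κ : ℝ, 0 < κ ∧ ∃ m : ℕ → ℕ,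
      ((fun n => (m n : ℝ)) =O[Filter.atTop] fun n : ℕ => (n : ℝ)) ∧
      Filter.Tendsto
        (fun n : ℕ => uniformProb (m n) fun F : Fin (m n) → KXor n k =>
          2 - ε ≤ (xorLP F).scpGap ⌊κ * n⌋₊)
        Filter.atTop (nhds 1)) ∧
    (∃ κ : ℝ, 0 < κ ∧ ∃ m : ℕ → ℕ,
      ((fun n => (m n : ℝ)) =O[Filter.atTop] fun n : ℕ => (n : ℝ)) ∧
      Filter.Tendsto
        (fun n : ℕ => uniformProb (m n) fun F : Fin (m n) → KClause n k =>
          (2 : ℝ) ^ k / ((2 : ℝ) ^ k - 1) - ε ≤ (cnfLP F).scpGap ⌊κ * n⌋₊)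
        Filter.atTop (nhds 1)) := by
  classical
  constructor
  · refine exists_tendsto_uniformProb_one hk (q := 1 / 2) (δ := ε / 4) (by norm_num) (by positivity)
      (fun n => KXor n k) (fun n hn => ?_) (fun n e => e.1.1)
      (fun n e x => ∀ C ∈ e.clauses, C.Sat x) (fun n W => card_kXor_subset_le W)
      (fun n x => card_kXor_sat_le x) (fun n m F d => (xorLP F).scpGap d) ?_
    · rw [← Fintype.card_pos_iff, card_kXor]
      exact Nat.mul_pos (Nat.choose_pos hn) two_pos
    · intro n m F d hd hm hexp hM
      have := inv_sub_le_scpGap_maxLP (e := F) (enc := fun i => (F i).clauses) (q := 1 / 2)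
        (fun i => subset_rfl) hd ⟨hk, fun i => (F i).1.2, by rwa [show 2 * (4 * d) = 8 * d by ring]⟩ le_rfl hε hm
        (fun i => (F i).exists_forall_sat (by omega)) fun x => by
          have := hM x
          rwa [Nat.card_eq_fintype_card, Fintype.card_subtype] at this
      norm_num at this ⊢
      exact this
  · have h64 : (2 : ℝ) ≤ (2 : ℝ) ^ k := le_self_pow₀ (by norm_num) (by omega)
    refine exists_tendsto_uniformProb_one hk (q := 1 - ((2 : ℝ) ^ k)⁻¹) (δ := ε / 4)
      (by linarith [show (0 : ℝ) < ((2 : ℝ) ^ k)⁻¹ by positivity]) (by positivity)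
      (fun n => KClause n k) (fun n hn => ?_) (fun n C => C.1.1 ∪ C.1.2)
      (fun n C x => (KClause.clause C).Sat x) (fun n W => card_kClause_subset_le W)
      (fun n x => card_kClause_sat_le x) (fun n m F d => (cnfLP F).scpGap d) ?_
    · rw [← Fintype.card_pos_iff, card_kClause]
      exact Nat.mul_pos (Nat.choose_pos hn) (by positivity)
    · intro n m F d hd hm hexp hM
      have hinv : (1 - ((2 : ℝ) ^ k)⁻¹)⁻¹ = (2 : ℝ) ^ k / ((2 : ℝ) ^ k - 1) := by
        have : (2 : ℝ) ^ k - 1 ≠ 0 := by linarith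
        field_simp
      rw [← hinv]
      -- The equations serve only to protect the fractional point; satisfiability is still counted
      -- for the clauses themselves.
      refine inv_sub_le_scpGap_maxLP (e := fun i => KClause.xor (F i)) (q := 1 - ((2 : ℝ) ^ k)⁻¹)
        (fun i => ?_) hd ⟨hk, fun i => (KClause.xor (F i)).1.2, by rwa [show 2 * (4 * d) = 8 * d by ring]⟩ ?_
        hε hm (fun i => ?_) fun x => ?_
      · rintro _ rfl
        exact KClause.clause_mem_xor (F i)
      · have := inv_anti₀ (by norm_num) h64
        linarith
      · obtain ⟨x, hx⟩ := KClause.exists_sat (by omega) (F i)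
        exact ⟨x, by rintro _ rfl; exact hx⟩
      · have := hM x
        rw [Nat.card_eq_fintype_card, Fintype.card_subtype] at this
        convert this using 4
        simp [KClause.clause]
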